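/- For $\nu\in\mathbb C$ and $-1<x\le 1$ let $$P_\nu(x)={}_2F_1\!\left(-\nu,\nu+1;1;\tfrac{1-x}{2}\right)$$ be the Legendre function of the first kind of degree $\nu$, and for $-1<x<1$ let $$Q_\nu(x)=\frac{\pi}{2\sin(\nu\pi)}\bigl[\cos(\nu\pi)P_\nu(x)-P_\nu(-x)\bigr]\quad(\nu\in\mathbb C\smallsetminus\mathbb Z),\qquad Q_m(x)=\lim_{\nu\to m}Q_\nu(x)\quad(m\in\mathbb Z_{\ge 0})$$ be the Legendre function of the second kind on the cut $(-1,1)$. **Proposition (Generalized Neumann Integrals).** Let $n\ge 0$ be an integer and let $\nu\in\mathbb C$ satisfy $\operatorname{Re}(\nu-n)>-1$. Then for every $x$ with $-1<x<1$ the Cauchy principal value below exists, and $$\mathcal P\!\int_{-1}^{1}\frac{(1+\xi)^{\nu-n}P_\nu(\xi)}{2(x-\xi)}\,d\xi=(1+x)^{\nu-n}Q_\nu(x).$$ Here $\mathcal P\!\int_{-1}^1=\lim_{\varepsilon\to0^+}\left(\int_{-1}^{x-\varepsilon}+\int_{x+\varepsilon}^{1}\right)$, and powers of positive reals are taken with the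 real logarithm. -/

import Mathlib

open Filter Topology

noncomputable section

/-- The Legendre function of the first kind `P_ν(x)` of arbitrary complex degree `ν`, for
`-1 < x ≤ 1`, as the Gauss hypergeometric function `₂F₁(-ν, ν + 1; 1; (1 - x) / 2)`. -/
def legendreP (ν : ℂ) (x : ℝ) : ℂ :=
  ₂F₁ (-ν) (ν + 1) (1 : ℂ) ((1 - (x : ℂ)) / 2)

/-- The expression `π / (2 sin(νπ)) * (cos(νπ) P_ν(x) - P_ν(-x))`, meaningful for `ν ∉ ℤ`. -/
def legendreQFormula (ν : ℂ) (x : ℝ) : ℂ :=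
  (Real.pi : ℂ) / (2 * Complex.sin (ν * Real.pi)) *
    (Complex.cos (ν * Real.pi) * legendreP ν x - legendreP ν (-x))

open scoped Classical in
/-- The Legendre function of the second kind `Q_ν(x)` for `-1 < x < 1`: the explicit formula for
`ν ∉ ℤ`, and the limit of that formula in the degree at the integers `ν = 0, 1, 2, …`
(negative integer degrees are excluded by convention: there the value is meaningless). -/
def legendreQ (ν : ℂ) (x : ℝ) : ℂ :=
  if ∃ m : ℤ, ν = m then limUnder (𝓝[≠] ν) (fun μ : ℂ => legendreQFormula μ x)
  else legendreQFormula ν x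

/-- The Cauchy principal value of `∫ f` over `(a, b)` with singular point `c ∈ (a, b)` exists and
equals `I`: `f` is integrable away from `c`, and the integrals over
`(a, c - ε)` and `(c + ε, b)` have a sum that tends to `I` as `ε → 0+`. -/
def HasCauchyPV (f : ℝ → ℂ) (a b c : ℝ) (I : ℂ) : Prop :=
  (∀ ε : ℝ, 0 < ε → a < c - ε → c + ε < b →
    IntervalIntegrable f MeasureTheory.volume a (c - ε) ∧
      IntervalIntegrable f MeasureTheory.volume (c + ε) b) ∧
  Tendsto (fun ε : ℝ => (∫ ξ in a..(c - ε), f ξ) + ∫ ξ in (c + ε)..b, f ξ) (𝓝[>] 0) (𝓝 I)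

end

namespace LegendreNeumann

open MeasureTheory Set

noncomputable section

/-! Put `s = (1 + ξ) / 2` and `y = (1 + x) / 2`, so that `P_ν` becomes `legP ν s`, a power series in
`1 - s`, and the kernel becomes `1 / (y - s)` on `(0, 1)`. Since `P_ν` grows at most logarithmically
at `s = 0`, the function `s ^ ν * P_ν` is integrable there as soon as `Re ν > -1`.

Case `n = 0`. In the strip `-1 < Re ν < 0`, Euler's integral takes Schläfli's form: `B(ν + 1, -ν) *
legP ν s` is the integral of `(r (1 - r)) ^ ν * (r - s) ^ (-ν - 1)` over `s < r < 1`. Inserting it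
in the Stieltjes transform of `s ^ ν * P_ν` at a nonreal `ζ` and exchanging integrals leaves an
elementary inner integral, and the transform becomes the integral over `(0, 1)` of `(r (1 - r)) ^ ν
* ζ⁻¹ * (1 - r / ζ) ^ (-ν - 1)` (`integral_legF_div_sub`). As `ζ` tends to `y` from above or below,
the part `r < y` yields `P_ν(-x)`, while `r > y` yields `P_ν(x)` times a phase `exp(±πi(-ν - 1))`;
the two phases add up to `-2 cos(νπ)`. By Sokhotski-Plemelj the two boundary values add up to twice
the principal value, and `B(ν + 1, -ν) * sin(νπ) = -π` produces the formula for `Q_ν`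
(`sin_mul_pvLegF_of_strip`). After multiplication by `sin(νπ)` both sides are holomorphic for `Re ν
> -1`, so the identity theorem removes the restriction to the strip (`sin_mul_pvLegF`); integer
degrees follow by continuity (`legendreQ_eq_pvLegF`).

General `n`. From `s / (y - s) + 1 = y / (y - s)`, lowering the power of `s` by one divides the
principal value by `y`, up to a moment of `P_ν` (`HasCauchyPV.of_mul`). Legendre's equation gives a
recursion for these moments in which the factor `σ (σ + 1) - ν (ν + 1)` is zero at `σ = ν`; hence
all the moments that occur vanish (`integral_cpow_mul_legP_eq_zero`). -/

/-! ### Power series with bounded coefficients -/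

/-- The sum of the complex power series with coefficients `a`. -/
def powerSum (a : ℕ → ℂ) (z : ℂ) : ℂ := ∑' k, a k * z ^ k

lemma summable_powerSum {a : ℕ → ℂ} {C : ℝ} (ha : ∀ k, ‖a k‖ ≤ C) {z : ℂ} (hz : ‖z‖ < 1) :
    Summable fun k => a k * z ^ k := by
  refine Summable.of_norm_bounded ((summable_geometric_of_lt_one (norm_nonneg z) hz).mul_left C)
    fun k => ?_
  rw [norm_mul, norm_pow]
  gcongr
  exact ha k

lemma norm_powerSum_le {a : ℕ → ℂ} {C : ℝ} (ha : ∀ k, ‖a k‖ ≤ C) {z : ℂ} (hz : ‖z‖ < 1) :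
    ‖powerSum a z‖ ≤ C / (1 - ‖z‖) := by
  rw [div_eq_mul_inv]
  refine tsum_of_norm_bounded ((hasSum_geometric_of_lt_one (norm_nonneg z) hz).mul_left C)
    fun k => ?_
  rw [norm_mul, norm_pow]
  gcongr
  exact ha k

lemma hasDerivAt_powerSum {a : ℕ → ℂ} {C : ℝ} (ha : ∀ k, ‖a k‖ ≤ C) {z : ℂ} (hz : ‖z‖ < 1) :
    HasDerivAt (powerSum a) (powerSum (fun k => (k + 1) * a (k + 1)) z) z := by
  -- Termwise differentiation needs a bound uniform near `z`; on the ball of radius `ρ < 1` it is `C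
  -- * k * ρ ^ (k - 1)`.
  obtain ⟨ρ, hzρ, hρ1⟩ := exists_between hz
  have hρ0 : 0 ≤ ρ := (norm_nonneg z).trans hzρ.le
  have hsum : Summable fun k : ℕ => C * (k * ρ ^ (k - 1)) := by
    refine Summable.mul_left C ?_
    refine (summable_nat_add_iff 1).mp ?_
    have h1 := summable_pow_mul_geometric_of_norm_lt_one 1
      (r := ρ) (by rwa [Real.norm_of_nonneg hρ0])
    have h2 := summable_geometric_of_lt_one hρ0 hρ1
    refine (h1.add h2).congr fun k => ?_
    simp
    ring
  have key := hasDerivAt_tsum_of_isPreconnected (g := fun k z => a k * z ^ k)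
    (g' := fun k z => a k * (k * z ^ (k - 1))) hsum Metric.isOpen_ball
    (convex_ball (0 : ℂ) ρ).isPreconnected
    (fun k y _ => (hasDerivAt_pow k y).const_mul (a k)) (fun k y hy => ?_)
    (y₀ := z) (by simpa using hzρ) (summable_powerSum ha hz) (y := z) (by simpa using hzρ)
  · have h0 : powerSum (fun k => (k + 1) * a (k + 1)) z = ∑' k, a k * (k * z ^ (k - 1)) := by
      have hs : Summable fun k : ℕ => a k * (k * z ^ (k - 1)) := by
        refine Summable.of_norm_bounded hsum fun k => ?_
        rw [norm_mul, norm_mul, norm_pow, Complex.norm_natCast]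
        have hC : 0 ≤ C := (norm_nonneg _).trans (ha k)
        gcongr
        exact ha k
      rw [hs.tsum_eq_zero_add]
      simp only [powerSum, Nat.cast_zero, zero_mul, mul_zero, zero_add, Nat.cast_add, Nat.cast_one,
        Nat.add_sub_cancel]
      exact tsum_congr fun k => by ring
    rw [h0]
    exact key
  · rw [norm_mul, norm_mul, norm_pow, Complex.norm_natCast]
    have : ‖y‖ ≤ ρ := by simpa using (Metric.mem_ball.mp hy).le
    have hC : 0 ≤ C := (norm_nonneg _).trans (ha k)
    gcongr
    exact ha k

/-! ### The Legendre series: coefficient bounds, growth at `s = 0`, Legendre's equation -/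

/-- The Taylor coefficients of the Legendre function `P_ν` in the variable `(1 - x) / 2`. -/
def legendreCoeff (ν : ℂ) (k : ℕ) : ℂ := ordinaryHypergeometricCoefficient (-ν) (ν + 1) 1 k

lemma legendreCoeff_zero (ν : ℂ) : legendreCoeff ν 0 = 1 := by
  simp [legendreCoeff, ordinaryHypergeometricCoefficient]

lemma legendreCoeff_succ (ν : ℂ) (k : ℕ) :
    ((k : ℂ) + 1) ^ 2 * legendreCoeff ν (k + 1)
      = (k * (k + 1) - ν * (ν + 1)) * legendreCoeff ν k := by
  have hk : (k : ℂ) + 1 ≠ 0 := Nat.cast_add_one_ne_zero k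
  simp only [legendreCoeff, ordinaryHypergeometricCoefficient, ascPochhammer_succ_eval,
    ascPochhammer_eval_one, Nat.factorial_succ, Nat.cast_mul, Nat.cast_succ, mul_inv]
  have hi := mul_inv_cancel₀ hk
  linear_combination (((k : ℂ) + 1) * ((k : ℂ) + 1)⁻¹ + 1) * (k.factorial : ℂ)⁻¹ ^ 2
    * ((ascPochhammer ℂ k).eval (-ν) * (-ν + k)) * ((ascPochhammer ℂ k).eval (ν + 1) * (ν + 1 + k))
    * hi

/-- By the recurrence, `(k + 1) ‖c_{k+1}‖` grows at each step by a factor at most `1 + M / ((k + 1)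
(k + 2))`, and the product of these factors converges. The decay `O(1 / k)`, uniform for `‖ν (ν +
1)‖ ≤ M`, is what makes the growth of `P_ν` at `s = 0` logarithmic. -/
lemma norm_legendreCoeff_succ_le {ν : ℂ} {M : ℝ} (hM : ‖ν * (ν + 1)‖ ≤ M) (k : ℕ) :
    ((k : ℝ) + 1) * ‖legendreCoeff ν (k + 1)‖ ≤ M * Real.exp M := by
  have hM0 : 0 ≤ M := (norm_nonneg _).trans hM
  -- The exponent is the telescoping sum of `1 / (j (j + 1))` for `j ≤ k`, which makes the induction
  -- close.
  suffices h : ((k : ℝ) + 1) * ‖legendreCoeff ν (k + 1)‖ ≤ M * Real.exp (M * (1 - 1 / (k + 1))) by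
    refine h.trans ?_
    gcongr
    have : (0 : ℝ) ≤ 1 / (k + 1) := by positivity
    nlinarith
  induction k with
  | zero =>
    have := legendreCoeff_succ ν 0
    simp only [Nat.cast_zero, zero_add, one_pow, one_mul, zero_sub, legendreCoeff_zero,
      mul_one] at this
    simpa [this] using hM
  | succ k ih =>
    have hrec := congrArg norm (legendreCoeff_succ ν (k + 1))
    rw [norm_mul, norm_mul, norm_pow] at hrec
    have e1 : ‖((k + 1 : ℕ) : ℂ) + 1‖ = (k : ℝ) + 2 := by
      rw [← Nat.cast_add_one, Complex.norm_natCast]; push_cast; ring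
    have e2 : ‖((k + 1 : ℕ) : ℂ) * (((k + 1 : ℕ) : ℂ) + 1) - ν * (ν + 1)‖
        ≤ ((k : ℝ) + 1) * (k + 2) + M := by
      refine (norm_sub_le _ _).trans ?_
      rw [norm_mul, e1, Complex.norm_natCast]
      push_cast
      gcongr
    rw [e1] at hrec
    set c := ‖legendreCoeff ν (k + 1)‖
    set c' := ‖legendreCoeff ν (k + 1 + 1)‖
    have hc : 0 ≤ c := norm_nonneg _
    have h1 : ((k : ℝ) + 2) ^ 2 * c' ≤ (((k : ℝ) + 1) * (k + 2) + M) * c := by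
      rw [hrec]; gcongr
    have h2 : ((k : ℝ) + 2) * c' ≤ (1 + M / ((k + 1) * (k + 2))) * ((k + 1) * c) := by
      have hk2 : (0 : ℝ) < k + 2 := by positivity
      rw [← mul_le_mul_iff_right₀ hk2]
      calc ((k : ℝ) + 2) * ((k + 2) * c') = (k + 2) ^ 2 * c' := by ring
        _ ≤ _ := h1
        _ = _ := by field_simp
    have h3 : 1 + M / (((k : ℝ) + 1) * (k + 2)) ≤ Real.exp (M / ((k + 1) * (k + 2))) := by
      have := Real.add_one_le_exp (M / (((k : ℝ) + 1) * (k + 2)))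
      linarith
    calc (((k + 1 : ℕ) : ℝ) + 1) * c' = ((k : ℝ) + 2) * c' := by push_cast; ring
      _ ≤ (1 + M / ((k + 1) * (k + 2))) * ((k + 1) * c) := h2
      _ ≤ Real.exp (M / ((k + 1) * (k + 2))) * (M * Real.exp (M * (1 - 1 / (k + 1)))) := by
        gcongr
      _ = M * Real.exp (M * (1 - 1 / (((k + 1 : ℕ) : ℝ) + 1))) := by
        rw [mul_left_comm, ← Real.exp_add]
        congr 2
        push_cast
        field_simp
        ring

lemma norm_legendreCoeff_le {ν : ℂ} {M : ℝ} (hM : ‖ν * (ν + 1)‖ ≤ M) (k : ℕ) :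
    ‖legendreCoeff ν k‖ ≤ 1 + M * Real.exp M := by
  have hM0 : 0 ≤ M := (norm_nonneg _).trans hM
  cases k with
  | zero => simp only [legendreCoeff_zero, norm_one]; nlinarith [Real.exp_pos M]
  | succ k =>
    have := norm_legendreCoeff_succ_le hM k
    have h0 : 0 ≤ (k : ℝ) * ‖legendreCoeff ν (k + 1)‖ := by positivity
    nlinarith

lemma differentiable_legendreCoeff (k : ℕ) : Differentiable ℂ fun ν => legendreCoeff ν k := by
  unfold legendreCoeff ordinaryHypergeometricCoefficient
  fun_prop

/-- The Legendre function `P_ν` in the variable `s = (1 + x) / 2`. -/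
def legP (ν : ℂ) (s : ℝ) : ℂ := powerSum (legendreCoeff ν) (1 - s)

/-- The derivative of `legP ν`. -/
def legP' (ν : ℂ) (s : ℝ) : ℂ :=
  -powerSum (fun k => (k + 1) * legendreCoeff ν (k + 1)) (1 - s)

lemma legendreP_eq_legP (ν : ℂ) (x : ℝ) : legendreP ν x = legP ν ((1 + x) / 2) := by
  rw [legendreP, ordinaryHypergeometric_eq_tsum, legP, powerSum]
  refine tsum_congr fun k => ?_
  rw [smul_eq_mul, legendreCoeff]
  congr 2
  push_cast
  ring

lemma norm_one_sub_ofReal_lt {s : ℝ} (h0 : 0 < s) (h1 : s ≤ 1) : ‖(1 : ℂ) - s‖ < 1 := by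
  rw [← Complex.ofReal_one, ← Complex.ofReal_sub, Complex.norm_real, Real.norm_eq_abs, abs_lt]
  constructor <;> linarith

lemma norm_one_sub_ofReal {s : ℝ} (h1 : s ≤ 1) : ‖(1 : ℂ) - s‖ = 1 - s := by
  rw [← Complex.ofReal_one, ← Complex.ofReal_sub, Complex.norm_real,
    Real.norm_of_nonneg (by linarith)]

lemma norm_succ_mul_legendreCoeff_succ_le {ν : ℂ} {M : ℝ} (hM : ‖ν * (ν + 1)‖ ≤ M) (k : ℕ) :
    ‖((k : ℂ) + 1) * legendreCoeff ν (k + 1)‖ ≤ M * Real.exp M := by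
  rw [norm_mul, ← Nat.cast_add_one, Complex.norm_natCast]
  exact_mod_cast norm_legendreCoeff_succ_le hM k

lemma hasDerivAt_legP (ν : ℂ) {s : ℝ} (h0 : 0 < s) (h1 : s ≤ 1) :
    HasDerivAt (legP ν) (legP' ν s) s := by
  have h := hasDerivAt_powerSum (norm_legendreCoeff_le (le_refl ‖ν * (ν + 1)‖))
    (norm_one_sub_ofReal_lt h0 h1)
  have h2 := h.comp (s : ℂ) ((hasDerivAt_id (s : ℂ)).const_sub 1)
  exact h2.comp_ofReal.congr_deriv (by simp [legP'])

lemma norm_legP'_le {ν : ℂ} {M : ℝ} (hM : ‖ν * (ν + 1)‖ ≤ M) {s : ℝ} (h0 : 0 < s) (h1 : s ≤ 1) :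
    ‖legP' ν s‖ ≤ M * Real.exp M / s := by
  have h := norm_powerSum_le (norm_succ_mul_legendreCoeff_succ_le hM)
    (norm_one_sub_ofReal_lt h0 h1)
  rw [norm_one_sub_ofReal h1, sub_sub_cancel] at h
  rwa [legP', norm_neg]

/-- With `c_{k+1} = O(1 / (k + 1))`, the series is compared with `∑ (1 - s) ^ (k + 1) / (k + 1) =
-log s`. -/
lemma norm_legP_le {ν : ℂ} {M : ℝ} (hM : ‖ν * (ν + 1)‖ ≤ M) {s : ℝ} (h0 : 0 < s) (h1 : s ≤ 1) :
    ‖legP ν s‖ ≤ 1 + M * Real.exp M * (-Real.log s) := by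
  have hz := norm_one_sub_ofReal_lt h0 h1
  have hs : 0 ≤ 1 - s := by linarith
  rw [legP, powerSum, (summable_powerSum (norm_legendreCoeff_le hM) hz).tsum_eq_zero_add]
  refine (norm_add_le _ _).trans (add_le_add (by simp [legendreCoeff_zero]) ?_)
  have hlog := Real.hasSum_pow_div_log_of_abs_lt_one (x := 1 - s)
    (by rw [abs_of_nonneg hs]; linarith)
  rw [sub_sub_cancel] at hlog
  refine tsum_of_norm_bounded (hlog.mul_left (M * Real.exp M)) fun k => ?_
  rw [norm_mul, norm_pow, norm_one_sub_ofReal h1, mul_div_assoc', div_eq_mul_inv, mul_right_comm]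
  gcongr
  rw [← div_eq_mul_inv, le_div_iff₀ (by positivity), mul_comm]
  exact norm_legendreCoeff_succ_le hM k

/-- Legendre's equation in divergence form. -/
lemma hasDerivAt_mul_legP' (ν : ℂ) {s : ℝ} (h0 : 0 < s) (h1 : s < 1) :
    HasDerivAt (fun t : ℝ => (t : ℂ) * (1 - t) * legP' ν t) (-(ν * (ν + 1)) * legP ν s) s := by
  set M := ‖ν * (ν + 1)‖
  have hc := norm_legendreCoeff_le (le_refl M)
  have hb := norm_succ_mul_legendreCoeff_succ_le (le_refl M)
  -- These are the coefficients of `z (1 - z)` times the derivative of the series, in the form the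
  -- recurrence gives: the term in `z ^ (k + 1)` is `(k + 1) c_{k+1} - k c_k = -ν (ν + 1) c_k / (k +
  -- 1)`. Division by zero makes `e 0 = 0`, as it must be.
  let e : ℕ → ℂ := fun k => -(ν * (ν + 1)) * legendreCoeff ν (k - 1) / k
  have he : ∀ k, ‖e k‖ ≤ M * (1 + M * Real.exp M) := by
    intro k
    have hM0 : 0 ≤ M := norm_nonneg _
    simp only [e]
    rw [norm_div, norm_mul, norm_neg, Complex.norm_natCast]
    rcases k.eq_zero_or_pos with rfl | hk
    · simp only [Nat.cast_zero, div_zero]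
      positivity
    · refine (div_le_self (by positivity) (by exact_mod_cast hk)).trans ?_
      gcongr
      exact hc _
  have hde : (fun k : ℕ => ((k : ℂ) + 1) * e (k + 1))
      = fun k => -(ν * (ν + 1)) * legendreCoeff ν k := by
    ext k
    have hk : (k : ℂ) + 1 ≠ 0 := Nat.cast_add_one_ne_zero k
    simp only [e, Nat.add_sub_cancel, Nat.cast_add, Nat.cast_one]
    field_simp
  have hmul : ∀ z : ℂ, ‖z‖ < 1 →
      z * (1 - z) * powerSum (fun k => (k + 1) * legendreCoeff ν (k + 1)) z = powerSum e z := by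
    intro z hz
    have hS := summable_powerSum hb hz
    have hA : z * powerSum (fun k => (k + 1) * legendreCoeff ν (k + 1)) z
        = ∑' k : ℕ, (k * legendreCoeff ν k) * z ^ k := by
      rw [Summable.tsum_eq_zero_add, powerSum, ← tsum_mul_left]
      · simp only [Nat.cast_zero, zero_mul, zero_add, Nat.cast_add, Nat.cast_one]
        exact tsum_congr fun k => by ring
      · refine (summable_nat_add_iff 1).mp ((hS.mul_left z).congr fun k => ?_)
        push_cast
        ring
    have hSA : Summable fun k : ℕ => (k * legendreCoeff ν k) * z ^ k := by
      refine (summable_nat_add_iff 1).mp ((hS.mul_left z).congr fun k => ?_)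
      push_cast
      ring
    have hE := summable_powerSum he hz
    calc z * (1 - z) * powerSum (fun k => (k + 1) * legendreCoeff ν (k + 1)) z
        = z * powerSum (fun k => (k + 1) * legendreCoeff ν (k + 1)) z
          - z * (z * powerSum (fun k => (k + 1) * legendreCoeff ν (k + 1)) z) := by ring
      _ = z * powerSum (fun k => (k + 1) * legendreCoeff ν (k + 1)) z
          - z * ∑' k : ℕ, (k * legendreCoeff ν k) * z ^ k := by rw [hA]
      _ = ∑' k : ℕ, (z * (((k : ℂ) + 1) * legendreCoeff ν (k + 1) * z ^ k)
            - z * ((k * legendreCoeff ν k) * z ^ k)) := by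
          rw [(hS.mul_left z).tsum_sub (hSA.mul_left z), tsum_mul_left, tsum_mul_left, powerSum]
      _ = powerSum e z := by
          rw [powerSum, hE.tsum_eq_zero_add]
          simp only [e, Nat.cast_zero, div_zero, zero_mul, zero_add, Nat.add_sub_cancel, Nat.cast_add,
            Nat.cast_one]
          refine tsum_congr fun k => ?_
          have hk : (k : ℂ) + 1 ≠ 0 := Nat.cast_add_one_ne_zero k
          have := legendreCoeff_succ ν k
          field_simp
          linear_combination z * z ^ k * this
  have hz := norm_one_sub_ofReal_lt h0 h1.le
  have hd := hasDerivAt_powerSum he hz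
  have h2 := (hd.comp (s : ℂ) ((hasDerivAt_id (s : ℂ)).const_sub 1)).neg.comp_ofReal
  have hval : powerSum (fun k => ((k : ℂ) + 1) * e (k + 1)) (1 - (s : ℂ))
      = -(ν * (ν + 1)) * legP ν s := by
    rw [hde, legP, powerSum, powerSum, ← tsum_mul_left]
    exact tsum_congr fun k => by ring
  rw [hval] at h2
  refine (h2.congr_of_eventuallyEq ?_).congr_deriv (by ring)
  filter_upwards [Ioo_mem_nhds h0 h1] with t ht
  have := hmul (1 - t) (norm_one_sub_ofReal_lt ht.1 ht.2.le)
  simp only [Pi.neg_apply, Function.comp_apply, ← this, legP']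
  ring

/-! ### Holomorphic dependence on the degree -/

lemma differentiable_legP {s : ℝ} (h0 : 0 < s) (h1 : s ≤ 1) :
    Differentiable ℂ fun ν => legP ν s := by
  have hz := norm_one_sub_ofReal_lt h0 h1
  intro ν₀
  let M := (‖ν₀‖ + 1) * (‖ν₀‖ + 1 + 1)
  have hM : ∀ ν ∈ Metric.ball ν₀ 1, ‖ν * (ν + 1)‖ ≤ M := by
    intro ν hν
    have h : ‖ν‖ ≤ ‖ν₀‖ + 1 := by
      have := norm_sub_norm_le ν ν₀
      rw [Metric.mem_ball, dist_eq_norm] at hν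
      linarith
    rw [norm_mul]
    refine mul_le_mul h ((norm_add_le _ _).trans ?_) (norm_nonneg _) (by positivity)
    rw [norm_one]
    linarith
  have := Complex.differentiableOn_tsum_of_summable_norm
    (F := fun k ν => legendreCoeff ν k * (1 - (s : ℂ)) ^ k)
    ((summable_geometric_of_lt_one (norm_nonneg _) hz).mul_left (1 + M * Real.exp M))
    (fun k => ((differentiable_legendreCoeff k).mul_const _).differentiableOn)
    (Metric.isOpen_ball (x := ν₀) (ε := 1)) (fun k ν hν => by
      rw [norm_mul, norm_pow]
      gcongr
      exact norm_legendreCoeff_le (hM ν hν) k)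
  exact this.differentiableAt (Metric.ball_mem_nhds ν₀ one_pos)

/-- Only the integrand itself has to be dominated, locally uniformly in the parameter: Cauchy's
estimate on small circles then dominates its derivative. -/
lemma differentiableOn_integral_of_dominated {α : Type*} [MeasurableSpace α] {μ : Measure α}
    {U : Set ℂ} (hU : IsOpen U) {F : ℂ → α → ℂ}
    (hm : ∀ z ∈ U, AEStronglyMeasurable (F z) μ)
    (hd : ∀ᵐ a ∂μ, DifferentiableOn ℂ (fun z => F z a) U)
    (hb : ∀ z₀ ∈ U, ∃ V ∈ 𝓝 z₀, ∃ b : α → ℝ, Integrable b μ ∧ ∀ᵐ a ∂μ, ∀ z ∈ V, ‖F z a‖ ≤ b a) :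
    DifferentiableOn ℂ (fun z => ∫ a, F z a ∂μ) U := by
  intro z₀ hz₀
  obtain ⟨V, hV, b, hbi, hFb⟩ := hb z₀ hz₀
  obtain ⟨ρ, hρ, hρs⟩ := Metric.mem_nhds_iff.mp (inter_mem hV (hU.mem_nhds hz₀))
  -- A third suffices: closed `r`-balls centred in the `r`-ball about `z₀` stay in the `ρ`-ball.
  set r := ρ / 3 with hr
  have hr0 : 0 < r := by positivity
  have hsub : ∀ z ∈ Metric.ball z₀ r, Metric.closedBall z r ⊆ V ∩ U := by
    intro z hz w hw
    apply hρs
    rw [Metric.mem_ball] at hz ⊢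
    rw [Metric.mem_closedBall] at hw
    have := dist_triangle w z z₀
    linarith
  have hball : Metric.ball z₀ r ⊆ V ∩ U := fun z hz => hsub z hz (Metric.mem_closedBall_self hr0.le)
  -- The derivative is measurable as a pointwise limit of difference quotients along a sequence of
  -- steps tending to `0`.
  have hmeas : AEStronglyMeasurable (fun a => deriv (fun z => F z a) z₀) μ := by
    let h : ℕ → ℂ := fun n => ((r / 2 / (n + 1) : ℝ) : ℂ)
    have hh0 : ∀ n, h n ≠ 0 := fun n => by
      simp only [h, ne_eq, Complex.ofReal_eq_zero]; positivity
    have hhr : ∀ n, z₀ + h n ∈ Metric.ball z₀ r := fun n => by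
      rw [Metric.mem_ball, dist_eq_norm, add_sub_cancel_left, Complex.norm_real,
        Real.norm_of_nonneg (by positivity)]
      have : r / 2 / ((n : ℝ) + 1) ≤ r / 2 := div_le_self (by positivity) (by linarith [n.cast_nonneg (α := ℝ)])
      linarith
    have hhlim : Tendsto h atTop (𝓝[≠] 0) := by
      refine tendsto_nhdsWithin_iff.mpr ⟨?_, Eventually.of_forall hh0⟩
      have := (tendsto_one_div_add_atTop_nhds_zero_nat (𝕜 := ℝ)).const_mul (r / 2)
      rw [mul_zero] at this
      have h2 := (Complex.continuous_ofReal.tendsto 0).comp this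
      rw [Complex.ofReal_zero] at h2
      refine h2.congr fun n => ?_
      simp [h, div_eq_mul_inv]
    refine aestronglyMeasurable_of_tendsto_ae atTop
      (f := fun n a => (h n)⁻¹ • (F (z₀ + h n) a - F z₀ a)) (fun n => ?_) ?_
    · exact ((hm _ (hball (hhr n)).2).sub (hm _ hz₀)).const_smul (h n)⁻¹
    · filter_upwards [hd] with a ha
      have hda := (ha.differentiableAt (hU.mem_nhds hz₀)).hasDerivAt
      exact (hasDerivAt_iff_tendsto_slope_zero.mp hda).comp hhlim
  refine (hasDerivAt_integral_of_dominated_loc_of_deriv_le (F := F)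
    (F' := fun z a => deriv (fun z => F z a) z) (bound := fun a => b a / r)
    (Metric.ball_mem_nhds z₀ hr0) ?_ ?_ hmeas ?_ (hbi.div_const r) ?_).2.differentiableAt.differentiableWithinAt
  · filter_upwards [hU.mem_nhds hz₀] with z hz using hm z hz
  · refine hbi.mono' (hm z₀ hz₀) ?_
    filter_upwards [hFb] with a ha using ha z₀ (mem_of_mem_nhds hV)
  · filter_upwards [hFb, hd] with a ha hda z hz
    refine Complex.norm_deriv_le_of_forall_mem_sphere_norm_le hr0 ?_ ?_
    · refine DifferentiableOn.diffContOnCl ?_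
      rw [closure_ball z hr0.ne']
      exact hda.mono fun w hw => (hsub z hz hw).2
    · exact fun w hw => ha w (hsub z hz (Metric.sphere_subset_closedBall hw)).1
  · filter_upwards [hd] with a hda z hz
    exact (hda.differentiableAt (hU.mem_nhds (hball hz).2)).hasDerivAt

/-! ### Bounds for `s ^ ν * P_ν` and its difference quotient, uniform in the degree -/

/-- The function `s ^ ν * P_ν` in the variable `s = (1 + x) / 2`. -/
def legF (ν : ℂ) (s : ℝ) : ℂ := (s : ℂ) ^ ν * legP ν s

lemma hasDerivAt_ofReal_cpow_const_of_pos {s : ℝ} (h0 : 0 < s) (ν : ℂ) :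
    HasDerivAt (fun t : ℝ => (t : ℂ) ^ ν) (ν * (s : ℂ) ^ (ν - 1)) s := by
  have h := ((hasDerivAt_id (s : ℂ)).cpow_const (c := ν) (Or.inl (by simpa using h0))).comp_ofReal
  simpa using h

lemma hasDerivAt_legF (ν : ℂ) {s : ℝ} (h0 : 0 < s) (h1 : s ≤ 1) :
    HasDerivAt (legF ν) (ν * (s : ℂ) ^ (ν - 1) * legP ν s + (s : ℂ) ^ ν * legP' ν s) s :=
  (hasDerivAt_ofReal_cpow_const_of_pos h0 ν).mul (hasDerivAt_legP ν h0 h1)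

lemma norm_legP_le_rpow {ν : ℂ} {M δ : ℝ} (hM : ‖ν * (ν + 1)‖ ≤ M) (hδ : 0 < δ) {s : ℝ}
    (h0 : 0 < s) (h1 : s ≤ 1) :
    ‖legP ν s‖ ≤ (1 + M * Real.exp M / δ) * s ^ (-δ) := by
  have hM0 : 0 ≤ M := (norm_nonneg _).trans hM
  have hl : -Real.log s ≤ s ^ (-δ) / δ := by
    have := Real.log_le_rpow_div (x := s⁻¹) (by positivity) hδ
    rwa [Real.log_inv, Real.inv_rpow h0.le, ← Real.rpow_neg h0.le] at this
  have h2 : 1 ≤ s ^ (-δ) := Real.one_le_rpow_of_pos_of_le_one_of_nonpos h0 h1 (by linarith)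
  calc ‖legP ν s‖ ≤ 1 + M * Real.exp M * (-Real.log s) := norm_legP_le hM h0 h1
    _ ≤ s ^ (-δ) + M * Real.exp M * (s ^ (-δ) / δ) := by gcongr
    _ = _ := by ring

lemma norm_ofReal_cpow_le {ν : ℂ} {a s : ℝ} (ha : a ≤ ν.re) (h0 : 0 < s) (h1 : s ≤ 1) :
    ‖(s : ℂ) ^ ν‖ ≤ s ^ a := by
  rw [Complex.norm_cpow_eq_rpow_re_of_pos h0]
  exact Real.rpow_le_rpow_of_exponent_ge h0 h1 ha

/-- Uniform bounds for `legF` and its derivative on bounded sets of degrees. -/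
lemma exists_bound_legF (N : ℝ) {δ : ℝ} (hδ : 0 < δ) : ∃ C, 0 ≤ C ∧ ∀ ν : ℂ, ‖ν‖ ≤ N →
    -1 + 2 * δ ≤ ν.re → ∀ s : ℝ, 0 < s → s ≤ 1 → ‖legF ν s‖ ≤ C * s ^ (δ - 1) ∧
      ‖ν * (s : ℂ) ^ (ν - 1) * legP ν s + (s : ℂ) ^ ν * legP' ν s‖ ≤ C * s ^ (δ - 2) := by
  let M := |N| * (|N| + 1)
  let B := M * Real.exp M
  have hB : 0 ≤ B := by positivity
  refine ⟨(|N| + 1) * (1 + B / δ) + B, by positivity, fun ν hN hre s h0 h1 => ?_⟩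
  have hN' : ‖ν‖ ≤ |N| := hN.trans (le_abs_self N)
  have hM : ‖ν * (ν + 1)‖ ≤ M := by
    rw [norm_mul]
    refine mul_le_mul hN' ((norm_add_le _ _).trans ?_) (norm_nonneg _) (by positivity)
    rw [norm_one]
    linarith
  have hP := norm_legP_le_rpow hM hδ h0 h1
  have hs := norm_ofReal_cpow_le (a := 2 * δ - 1) (by linarith) h0 h1
  have hs' : ‖(s : ℂ) ^ (ν - 1)‖ ≤ s ^ (2 * δ - 2) :=
    norm_ofReal_cpow_le (by simp; linarith) h0 h1
  -- Of the margin `2 * δ`, one `δ` pays for the logarithm in `P_ν`; the other keeps `s ^ (δ - 1)`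
  -- integrable at `0`.
  have e1 : s ^ (2 * δ - 1) * s ^ (-δ) = s ^ (δ - 1) := by
    rw [← Real.rpow_add h0]; ring_nf
  have e2 : s ^ (2 * δ - 2) * s ^ (-δ) = s ^ (δ - 2) := by
    rw [← Real.rpow_add h0]; ring_nf
  have e3 : s ^ (2 * δ - 1) / s = s ^ (2 * δ - 2) := by
    nth_rw 2 [← Real.rpow_one s]
    rw [← Real.rpow_sub h0]; ring_nf
  have e4 : s ^ (2 * δ - 2) ≤ s ^ (δ - 2) := Real.rpow_le_rpow_of_exponent_ge h0 h1 (by linarith)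
  have hp1 : 0 < s ^ (δ - 1) := Real.rpow_pos_of_pos h0 _
  have hp2 : 0 < s ^ (δ - 2) := Real.rpow_pos_of_pos h0 _
  have hBδ : 0 ≤ B / δ := by positivity
  constructor
  · calc ‖legF ν s‖ ≤ s ^ (2 * δ - 1) * ((1 + B / δ) * s ^ (-δ)) := by
          rw [legF, norm_mul]; gcongr
      _ = (1 + B / δ) * s ^ (δ - 1) := by rw [← e1]; ring
      _ ≤ _ := by
        refine mul_le_mul_of_nonneg_right ?_ hp1.le
        nlinarith [abs_nonneg N, mul_nonneg (abs_nonneg N) hBδ]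
  · calc _ ≤ ‖ν‖ * ‖(s : ℂ) ^ (ν - 1)‖ * ‖legP ν s‖ + ‖(s : ℂ) ^ ν‖ * ‖legP' ν s‖ := by
          refine (norm_add_le _ _).trans_eq ?_
          simp only [norm_mul]
      _ ≤ |N| * s ^ (2 * δ - 2) * ((1 + B / δ) * s ^ (-δ)) + s ^ (2 * δ - 1) * (B / s) := by
          gcongr
          exact norm_legP'_le hM h0 h1
      _ = |N| * (1 + B / δ) * (s ^ (2 * δ - 2) * s ^ (-δ)) + B * (s ^ (2 * δ - 1) / s) := by ring
      _ ≤ |N| * (1 + B / δ) * s ^ (δ - 2) + B * s ^ (δ - 2) := by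
          rw [e2, e3]
          exact add_le_add le_rfl (mul_le_mul_of_nonneg_left e4 hB)
      _ ≤ _ := by
          rw [← add_mul]
          gcongr
          linarith

lemma exists_bound_legF_slope (N : ℝ) {δ y : ℝ} (hδ : 0 < δ) (hδ1 : δ ≤ 1) (hy0 : 0 < y)
    (hy1 : y ≤ 1) : ∃ C, 0 ≤ C ∧ ∀ ν : ℂ, ‖ν‖ ≤ N → -1 + 2 * δ ≤ ν.re → ∀ s : ℝ, 0 < s → s ≤ 1 →
      ‖(legF ν s - legF ν y) / (y - s)‖ ≤ C * s ^ (δ - 1) := by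
  obtain ⟨C, hC0, hC⟩ := exists_bound_legF N hδ
  refine ⟨4 * C / y + C * (y / 2) ^ (δ - 2), by positivity, fun ν hN hre s h0 h1 => ?_⟩
  have hp1 : 1 ≤ s ^ (δ - 1) :=
    Real.one_le_rpow_of_pos_of_le_one_of_nonpos h0 h1 (by linarith)
  have hp2 : 0 < (y / 2) ^ (δ - 2) := Real.rpow_pos_of_pos (by positivity) _
  -- Below `y / 2` the denominator is at least `y / 2`; above it the mean value inequality applies,
  -- away from the singularity at `0`.
  rcases lt_or_ge s (y / 2) with hs | hs
  · have hden : y / 2 ≤ ‖(y : ℂ) - s‖ := by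
      rw [← Complex.ofReal_sub, Complex.norm_real]
      exact le_trans (by linarith) (le_abs_self _)
    have hyp : y ^ (δ - 1) ≤ s ^ (δ - 1) :=
      Real.rpow_le_rpow_of_nonpos h0 (by linarith) (by linarith)
    have hnum : ‖legF ν s - legF ν y‖ ≤ 2 * C * s ^ (δ - 1) := by
      refine (norm_sub_le _ _).trans ?_
      have a1 := (hC ν hN hre s h0 h1).1
      have a2 := (hC ν hN hre y hy0 hy1).1
      have a3 := mul_le_mul_of_nonneg_left hyp hC0
      linarith
    rw [norm_div]
    calc _ ≤ 2 * C * s ^ (δ - 1) / (y / 2) := by gcongr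
      _ = 4 * C / y * s ^ (δ - 1) := by field_simp; ring
      _ ≤ _ := by gcongr; linarith [mul_nonneg hC0 hp2.le]
  · have hlip : ‖legF ν s - legF ν y‖ ≤ C * (y / 2) ^ (δ - 2) * ‖s - y‖ := by
      refine (convex_Icc (y / 2) 1).norm_image_sub_le_of_norm_hasDerivWithin_le
        (f' := fun t : ℝ => ν * (t : ℂ) ^ (ν - 1) * legP ν t + (t : ℂ) ^ ν * legP' ν t)
        (fun t ht => (hasDerivAt_legF ν (by linarith [ht.1]) ht.2).hasDerivWithinAt)
        (fun t ht => ?_) ⟨by linarith, hy1⟩ ⟨hs, h1⟩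
      refine (hC ν hN hre t (by linarith [ht.1]) ht.2).2.trans ?_
      gcongr 1
      by_cases h2 : δ ≤ 2
      · exact Real.rpow_le_rpow_of_nonpos (by positivity) ht.1 (by linarith)
      · linarith
    have hle : ‖(legF ν s - legF ν y) / (y - s)‖ ≤ C * (y / 2) ^ (δ - 2) := by
      rw [norm_div, ← Complex.ofReal_sub, Complex.norm_real, norm_sub_rev y s]
      exact div_le_of_le_mul₀ (norm_nonneg _) (by positivity) hlip
    calc _ ≤ C * (y / 2) ^ (δ - 2) := hle
      _ ≤ (4 * C / y + C * (y / 2) ^ (δ - 2)) * 1 := by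
          have : 0 ≤ 4 * C / y := by positivity
          linarith
      _ ≤ _ := by gcongr

lemma continuousOn_legF (ν : ℂ) : ContinuousOn (legF ν) (Ioc 0 1) :=
  fun _ hs => (hasDerivAt_legF ν hs.1 hs.2).continuousAt.continuousWithinAt

lemma continuousOn_legP (ν : ℂ) : ContinuousOn (legP ν) (Ioc 0 1) :=
  fun _ hs => (hasDerivAt_legP ν hs.1 hs.2).continuousAt.continuousWithinAt

lemma aestronglyMeasurable_legF_slope (ν : ℂ) (y : ℝ) :
    AEStronglyMeasurable (fun s : ℝ => (legF ν s - legF ν y) / (y - s))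
      (volume.restrict (Ioc 0 1)) := by
  refine AEStronglyMeasurable.div₀ ?_ (by fun_prop)
  exact (((continuousOn_legF ν).sub continuousOn_const).aestronglyMeasurable measurableSet_Ioc)

lemma integrableOn_rpow_sub_one {δ : ℝ} (hδ : 0 < δ) :
    IntegrableOn (fun s : ℝ => s ^ (δ - 1)) (Ioc 0 1) :=
  (intervalIntegrable_iff_integrableOn_Ioc_of_le zero_le_one).mp
    (intervalIntegral.intervalIntegrable_rpow' (by linarith))

lemma exists_delta {ν : ℂ} (h : -1 < ν.re) : ∃ δ, 0 < δ ∧ δ ≤ 1 ∧ -1 + 2 * δ < ν.re := by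
  -- The divisor `3` makes the last inequality strict, so the same `δ` serves a neighbourhood of
  -- `ν`.
  refine ⟨min 1 ((ν.re + 1) / 3), by rw [lt_min_iff]; constructor <;> linarith, min_le_left _ _, ?_⟩
  have := min_le_right 1 ((ν.re + 1) / 3)
  linarith

lemma integrableOn_cpow_mul_legP (ν : ℂ) {σ : ℂ} (h : -1 < σ.re) :
    IntegrableOn (fun s : ℝ => (s : ℂ) ^ σ * legP ν s) (Ioc 0 1) := by
  obtain ⟨δ, h0, -, h2⟩ := exists_delta h
  refine ((integrableOn_rpow_sub_one h0).const_mul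
    (1 + ‖ν * (ν + 1)‖ * Real.exp ‖ν * (ν + 1)‖ / δ)).mono' ?_ ?_
  · refine ContinuousOn.aestronglyMeasurable (ContinuousOn.mul (fun s hs => ?_)
      (continuousOn_legP ν)) measurableSet_Ioc
    exact (hasDerivAt_ofReal_cpow_const_of_pos hs.1 σ).continuousAt.continuousWithinAt
  · filter_upwards [ae_restrict_mem measurableSet_Ioc] with s hs
    have h3 := norm_legP_le_rpow (le_refl ‖ν * (ν + 1)‖) h0 hs.1 hs.2
    have h4 := norm_ofReal_cpow_le (a := 2 * δ - 1) (by linarith) hs.1 hs.2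
    have h5 := Real.rpow_pos_of_pos hs.1 (2 * δ - 1)
    have e1 : s ^ (2 * δ - 1) * s ^ (-δ) = s ^ (δ - 1) := by
      rw [← Real.rpow_add hs.1]; ring_nf
    rw [norm_mul, ← e1, mul_left_comm]
    gcongr

lemma integrableOn_legF_slope {ν : ℂ} (h : -1 < ν.re) {y : ℝ} (hy0 : 0 < y) (hy1 : y ≤ 1) :
    IntegrableOn (fun s : ℝ => (legF ν s - legF ν y) / (y - s)) (Ioc 0 1) := by
  obtain ⟨δ, h0, h1, h2⟩ := exists_delta h
  obtain ⟨C, -, hC⟩ := exists_bound_legF_slope ‖ν‖ h0 h1 hy0 hy1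
  refine ((integrableOn_rpow_sub_one h0).const_mul C).mono'
    (aestronglyMeasurable_legF_slope ν y) ?_
  filter_upwards [ae_restrict_mem measurableSet_Ioc] with s hs
  exact hC ν le_rfl h2.le s hs.1 hs.2

lemma differentiable_legF {s : ℝ} (h0 : 0 < s) (h1 : s ≤ 1) :
    Differentiable ℂ fun ν => legF ν s := by
  have hs : (s : ℂ) ≠ 0 := by exact_mod_cast h0.ne'
  exact (differentiable_id.const_cpow (Or.inl hs)).mul (differentiable_legP h0 h1)

/-- The principal value of the integral of `legF ν s / (y - s)` over `(0, 1)`, as an absolutely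
convergent integral. -/
def pvLegF (y : ℝ) (ν : ℂ) : ℂ :=
  (∫ s in Ioc 0 1, (legF ν s - legF ν y) / (y - s)) + legF ν y * Real.log (y / (1 - y))

lemma isOpen_re_gt_neg_one : IsOpen {ν : ℂ | -1 < ν.re} :=
  isOpen_lt continuous_const Complex.continuous_re

lemma differentiableOn_pvLegF {y : ℝ} (hy0 : 0 < y) (hy1 : y ≤ 1) :
    DifferentiableOn ℂ (pvLegF y) {ν | -1 < ν.re} := by
  refine DifferentiableOn.add ?_ ((differentiable_legF hy0 hy1).mul_const _).differentiableOn
  refine differentiableOn_integral_of_dominated isOpen_re_gt_neg_one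
    (fun ν _ => aestronglyMeasurable_legF_slope ν y) ?_ fun ν₀ hν₀ => ?_
  · filter_upwards [ae_restrict_mem measurableSet_Ioc] with s hs
    exact (((differentiable_legF hs.1 hs.2).sub
      (differentiable_legF hy0 hy1)).div_const _).differentiableOn
  · obtain ⟨δ, h0, h1, h2⟩ := exists_delta hν₀
    obtain ⟨C, -, hC⟩ := exists_bound_legF_slope (‖ν₀‖ + 1) h0 h1 hy0 hy1
    refine ⟨{ν | ‖ν‖ < ‖ν₀‖ + 1} ∩ {ν | -1 + 2 * δ < ν.re}, inter_mem ?_ ?_,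
      fun s => C * s ^ (δ - 1), (integrableOn_rpow_sub_one h0).const_mul C, ?_⟩
    · exact (isOpen_lt continuous_norm continuous_const).mem_nhds (by simp)
    · exact (isOpen_lt continuous_const Complex.continuous_re).mem_nhds h2
    · filter_upwards [ae_restrict_mem measurableSet_Ioc] with s hs ν hν
      exact hC ν hν.1.le hν.2.le s hs.1 hs.2

/-! ### Calculus of principal values -/

lemma integral_one_div_sub_left {y ε : ℝ} (hε : 0 < ε) (hy : 0 < y) :
    ∫ s in (0 : ℝ)..(y - ε), 1 / ((y : ℂ) - s) = ((Real.log y - Real.log ε : ℝ) : ℂ) := by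
  have h := intervalIntegral.integral_comp_sub_left (a := 0) (b := y - ε) (fun x : ℝ => 1 / x) y
  rw [sub_sub_cancel, sub_zero, integral_one_div_of_pos hε hy, Real.log_div hy.ne' hε.ne'] at h
  rw [← h, ← intervalIntegral.integral_ofReal]
  push_cast
  rfl

lemma integral_one_div_sub_right {y ε : ℝ} (hε : 0 < ε) (hy : y < 1) :
    ∫ s in (y + ε)..1, 1 / ((y : ℂ) - s) = ((Real.log ε - Real.log (1 - y) : ℝ) : ℂ) := by
  have h := intervalIntegral.integral_comp_sub_left (a := y + ε) (b := 1) (fun x : ℝ => 1 / x) y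
  have hy' : y - 1 < 0 := by linarith
  rw [sub_add_cancel_left, integral_one_div_of_neg hy' (by linarith : -ε < 0),
    show -ε / (y - 1) = ε / (1 - y) by rw [← neg_div_neg_eq]; ring_nf,
    Real.log_div hε.ne' (by linarith)] at h
  rw [← h, ← intervalIntegral.integral_ofReal]
  push_cast
  rfl

lemma intervalIntegrable_one_div_sub {y a b : ℝ} (h : y ∉ uIcc a b) :
    IntervalIntegrable (fun s : ℝ => 1 / ((y : ℂ) - s)) volume a b := by
  refine ContinuousOn.intervalIntegrable (ContinuousOn.div continuousOn_const
    (by fun_prop) fun s hs h0 => h ?_)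
  have : y = s := by exact_mod_cast sub_eq_zero.mp h0
  rwa [this]

lemma tendsto_sub_nhdsGT (y : ℝ) : Tendsto (fun ε : ℝ => y - ε) (𝓝[>] 0) (𝓝 y) := by
  have : Tendsto (fun ε : ℝ => y - ε) (𝓝 0) (𝓝 (y - 0)) := tendsto_id.const_sub y
  rw [sub_zero] at this
  exact this.mono_left nhdsWithin_le_nhds

lemma tendsto_add_nhdsGT (y : ℝ) : Tendsto (fun ε : ℝ => y + ε) (𝓝[>] 0) (𝓝 y) := by
  have : Tendsto (fun ε : ℝ => y + ε) (𝓝 0) (𝓝 (y + 0)) := tendsto_id.const_add y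
  rw [add_zero] at this
  exact this.mono_left nhdsWithin_le_nhds

lemma intervalIntegrable_of_integrableOn_Ioc {f : ℝ → ℂ} (hf : IntegrableOn f (Ioc 0 1)) {a b : ℝ}
    (ha : a ∈ Icc (0 : ℝ) 1) (hb : b ∈ Icc (0 : ℝ) 1) : IntervalIntegrable f volume a b := by
  refine ((intervalIntegrable_iff_integrableOn_Ioc_of_le zero_le_one).mpr hf).mono_set ?_
  rw [uIcc_of_le (zero_le_one' ℝ)]
  exact ordConnected_Icc.uIcc_subset ha hb

lemma tendsto_integral_add_integral_of_integrableOn {f : ℝ → ℂ} {y : ℝ} (hy0 : 0 < y) (hy1 : y < 1)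
    (hf : IntegrableOn f (Ioc 0 1)) :
    Tendsto (fun ε : ℝ => (∫ s in (0 : ℝ)..(y - ε), f s) + ∫ s in (y + ε)..1, f s)
      (𝓝[>] 0) (𝓝 (∫ s in Ioc 0 1, f s)) := by
  have hsub := @intervalIntegrable_of_integrableOn_Ioc f hf
  rw [← intervalIntegral.integral_of_le (zero_le_one' ℝ),
    ← intervalIntegral.integral_add_adjacent_intervals (hsub (by simp) ⟨hy0.le, hy1.le⟩)
      (hsub ⟨hy0.le, hy1.le⟩ (by simp))]
  have hc := intervalIntegral.continuousOn_primitive_interval' (hsub (a := 0) (b := 1) (by simp)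
    (by simp)) (a := y) (by rw [uIcc_of_le zero_le_one]; exact ⟨hy0.le, hy1.le⟩)
  have hca : ContinuousAt (fun b => ∫ s in y..b, f s) y :=
    hc.continuousAt (by rw [uIcc_of_le zero_le_one]; exact Icc_mem_nhds hy0 hy1)
  rw [ContinuousAt, intervalIntegral.integral_same] at hca
  have hl := (hca.comp (tendsto_sub_nhdsGT y)).const_add (∫ s in (0 : ℝ)..y, f s)
  have hr := ((hca.comp (tendsto_add_nhdsGT y)).neg).const_add (∫ s in y..1, f s)
  rw [add_zero] at hl
  rw [neg_zero, add_zero] at hr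
  refine (hl.add hr).congr' ?_
  filter_upwards [Ioo_mem_nhdsGT (lt_min hy0 (sub_pos.mpr hy1))] with ε hε
  have h1 := hε.2.trans_le (min_le_left _ _)
  have h2 := hε.2.trans_le (min_le_right _ _)
  have h0 := hε.1
  simp only [Function.comp_apply]
  rw [intervalIntegral.integral_add_adjacent_intervals, ← intervalIntegral.integral_symm,
    add_comm (∫ s in y..1, _), intervalIntegral.integral_add_adjacent_intervals]
  all_goals apply hsub <;> constructor <;> linarith

/-- A function whose difference quotient at `y` is integrable has a principal value integral. -/
lemma hasCauchyPV_of_integrableOn_slope {f : ℝ → ℂ} {y : ℝ} (hy0 : 0 < y) (hy1 : y < 1)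
    (hs : IntegrableOn (fun s : ℝ => (f s - f y) / (y - s)) (Ioc 0 1)) :
    HasCauchyPV (fun s => f s / (y - s)) 0 1 y
      ((∫ s in Ioc 0 1, (f s - f y) / (y - s)) + f y * Real.log (y / (1 - y))) := by
  -- Subtracting `f y` leaves an integrable quotient plus `f y / (y - s)`, in whose integrals the
  -- two terms `log ε` cancel and leave `log (y / (1 - y))`.
  have hdec : (fun s : ℝ => f s / ((y : ℂ) - s))
      = fun s : ℝ => (f s - f y) / ((y : ℂ) - s) + f y * (1 / ((y : ℂ) - s)) := by
    ext s; ring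
  have hsub := fun a b => @intervalIntegrable_of_integrableOn_Ioc _ hs a b
  have hleft : ∀ ε : ℝ, 0 < ε → 0 < y - ε →
      IntervalIntegrable (fun s : ℝ => 1 / ((y : ℂ) - s)) volume 0 (y - ε) := by
    intro ε h1 h2
    refine intervalIntegrable_one_div_sub ?_
    rw [uIcc_of_le h2.le, mem_Icc]
    rintro ⟨-, h⟩
    linarith
  have hright : ∀ ε : ℝ, 0 < ε → y + ε < 1 →
      IntervalIntegrable (fun s : ℝ => 1 / ((y : ℂ) - s)) volume (y + ε) 1 := by
    intro ε h1 h2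
    refine intervalIntegrable_one_div_sub ?_
    rw [uIcc_of_le h2.le, mem_Icc]
    rintro ⟨h, -⟩
    linarith
  rw [HasCauchyPV, hdec]
  refine ⟨fun ε h1 h2 h3 => ⟨(hsub _ _ ?_ ?_).add ((hleft ε h1 h2).const_mul _),
    (hsub _ _ ?_ ?_).add ((hright ε h1 h3).const_mul _)⟩, ?_⟩
  any_goals constructor <;> linarith
  have hlim : Tendsto (fun ε : ℝ => (∫ s in (0 : ℝ)..(y - ε), (f s - f y) / ((y : ℂ) - s))
      + (∫ s in (y + ε)..1, (f s - f y) / ((y : ℂ) - s)) + f y * Real.log (y / (1 - y)))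
      (𝓝[>] 0) (𝓝 ((∫ s in Ioc 0 1, (f s - f y) / (y - s)) + f y * Real.log (y / (1 - y)))) := by
    exact (tendsto_integral_add_integral_of_integrableOn hy0 hy1 hs).add tendsto_const_nhds
  refine hlim.congr' ?_
  filter_upwards [Ioo_mem_nhdsGT (lt_min hy0 (sub_pos.mpr hy1))] with ε hε
  have h1 := hε.2.trans_le (min_le_left _ _)
  have h2 := hε.2.trans_le (min_le_right _ _)
  have h0 := hε.1
  rw [intervalIntegral.integral_add (hsub _ _ ⟨by linarith, by linarith⟩ ⟨by linarith, by linarith⟩)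
      ((hleft ε h0 (by linarith)).const_mul _),
    intervalIntegral.integral_add (hsub _ _ ⟨by linarith, by linarith⟩ ⟨by linarith, by linarith⟩)
      ((hright ε h0 (by linarith)).const_mul _),
    intervalIntegral.integral_const_mul, intervalIntegral.integral_const_mul,
    integral_one_div_sub_left h0 hy0, integral_one_div_sub_right h0 hy1,
    Real.log_div hy0.ne' (by linarith)]
  push_cast
  ring

/-- Lowering the power of `s` in a principal value integral by one. -/
lemma _root_.HasCauchyPV.of_mul {f : ℝ → ℂ} {y : ℝ} {I : ℂ} (hy0 : 0 < y) (hy1 : y < 1)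
    (hf : IntegrableOn f (Ioc 0 1)) (h : HasCauchyPV (fun s => s * f s / (y - s)) 0 1 y I) :
    HasCauchyPV (fun s => f s / (y - s)) 0 1 y ((I + ∫ s in Ioc 0 1, f s) / y) := by
  have hsub := fun a b => @intervalIntegrable_of_integrableOn_Ioc _ hf a b
  have hyc : (y : ℂ) ≠ 0 := by exact_mod_cast hy0.ne'
  have hdec : ∀ s : ℝ, s ≠ y → (s * f s / ((y : ℂ) - s) + f s) / y = f s / ((y : ℂ) - s) := by
    intro s hs
    have : (y : ℂ) - s ≠ 0 := sub_ne_zero.mpr (by exact_mod_cast hs.symm)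
    field_simp
    ring
  have hl : ∀ ε : ℝ, 0 < ε → 0 < y - ε → EqOn (fun s : ℝ => (s * f s / ((y : ℂ) - s) + f s) / y)
      (fun s => f s / ((y : ℂ) - s)) (uIcc 0 (y - ε)) := by
    intro ε h1 h2 s hs
    rw [uIcc_of_le h2.le] at hs
    exact hdec s (by linarith [hs.2])
  have hr : ∀ ε : ℝ, 0 < ε → y + ε < 1 → EqOn (fun s : ℝ => (s * f s / ((y : ℂ) - s) + f s) / y)
      (fun s => f s / ((y : ℂ) - s)) (uIcc (y + ε) 1) := by
    intro ε h1 h2 s hs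
    rw [uIcc_of_le h2.le] at hs
    exact hdec s (by linarith [hs.1])
  refine ⟨fun ε h1 h2 h3 => ?_, ?_⟩
  · obtain ⟨i1, i2⟩ := h.1 ε h1 h2 h3
    refine ⟨((i1.add (hsub _ _ ?_ ?_)).div_const _).congr fun s hs => hl ε h1 h2 (uIoc_subset_uIcc hs),
      ((i2.add (hsub _ _ ?_ ?_)).div_const _).congr fun s hs => hr ε h1 h3 (uIoc_subset_uIcc hs)⟩
    all_goals constructor <;> linarith
  · have hlim := tendsto_integral_add_integral_of_integrableOn hy0 hy1 hf
    refine ((h.2.add hlim).div_const (y : ℂ)).congr' ?_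
    filter_upwards [Ioo_mem_nhdsGT (lt_min hy0 (sub_pos.mpr hy1))] with ε hε
    have h1 := hε.2.trans_le (min_le_left _ _)
    have h2 := hε.2.trans_le (min_le_right _ _)
    have h0 := hε.1
    obtain ⟨i1, i2⟩ := h.1 ε h0 (by linarith) (by linarith)
    rw [← intervalIntegral.integral_congr (hl ε h0 (by linarith)),
      ← intervalIntegral.integral_congr (hr ε h0 (by linarith)),
      intervalIntegral.integral_div, intervalIntegral.integral_div,
      intervalIntegral.integral_add i1 (hsub _ _ ⟨by linarith, by linarith⟩
        ⟨by linarith, by linarith⟩),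
      intervalIntegral.integral_add i2 (hsub _ _ ⟨by linarith, by linarith⟩
        ⟨by linarith, by linarith⟩)]
    ring

/-- The affine change of variable `s = (1 + ξ) / 2` in a principal value integral. -/
lemma _root_.HasCauchyPV.comp_affine {f : ℝ → ℂ} {x : ℝ} {I : ℂ}
    (h : HasCauchyPV f 0 1 ((1 + x) / 2) I) :
    HasCauchyPV (fun ξ => f ((1 + ξ) / 2)) (-1) 1 x (2 * I) := by
  have e : ∀ a b : ℝ, ∫ ξ in a..b, f ((1 + ξ) / 2)
      = 2 * ∫ s in ((1 + a) / 2)..((1 + b) / 2), f s := by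
    intro a b
    have := intervalIntegral.integral_comp_add_div (a := a) (b := b) f (two_ne_zero' ℝ) (1 / 2)
    simp only [← add_div] at this
    rw [this, Complex.real_smul, Complex.ofReal_ofNat]
  have hi : ∀ a b : ℝ, a ≤ b → IntervalIntegrable f volume ((1 + a) / 2) ((1 + b) / 2) →
      IntervalIntegrable (fun ξ => f ((1 + ξ) / 2)) volume a b := by
    intro a b hab hf
    have h1 := (hf.comp_mul_left (c := 1 / 2) (by simp) (by simp)).comp_add_right 1 (by simp)
    convert h1 using 1
    · ext ξ; ring_nf
    all_goals ring
  refine ⟨fun ε h1 h2 h3 => ?_, ?_⟩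
  · obtain ⟨i1, i2⟩ := h.1 (ε / 2) (by linarith) (by linarith) (by linarith)
    refine ⟨hi _ _ (by linarith) ?_, hi _ _ (by linarith) ?_⟩
    · convert i1 using 1 <;> ring
    · convert i2 using 1 <;> ring
  · have hε : Tendsto (fun ε : ℝ => ε / 2) (𝓝[>] 0) (𝓝[>] 0) := by
      refine tendsto_nhdsWithin_iff.mpr ⟨?_, ?_⟩
      · have : Tendsto (fun ε : ℝ => ε / 2) (𝓝 0) (𝓝 (0 / 2)) := tendsto_id.div_const 2
        rw [zero_div] at this
        exact this.mono_left nhdsWithin_le_nhds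
      · filter_upwards [self_mem_nhdsWithin] with ε (hε : 0 < ε)
        exact half_pos hε
    refine ((h.2.comp hε).const_mul 2).congr fun ε => ?_
    simp only [Function.comp_apply]
    rw [e, e, mul_add]
    congr 3 <;> ring_nf

/-! ### The Sokhotski-Plemelj formula -/

lemma integral_poisson_conj (y : ℝ) {ε : ℝ} (hε : 0 < ε) :
    ∫ s in (0 : ℝ)..1, 2 * (y - s) / ((y - s) ^ 2 + ε ^ 2)
      = Real.log (y ^ 2 + ε ^ 2) - Real.log ((1 - y) ^ 2 + ε ^ 2) := by
  have hpos : ∀ s : ℝ, (y - s) ^ 2 + ε ^ 2 ≠ 0 := fun s => by positivity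
  rw [intervalIntegral.integral_eq_sub_of_hasDerivAt
    (f := fun s => -Real.log ((y - s) ^ 2 + ε ^ 2)) (fun s _ => ?_)
    (Continuous.intervalIntegrable (by fun_prop (disch := exact hpos _)) _ _)]
  · ring_nf
  · have h := (((((hasDerivAt_id s).const_sub y).pow 2).add_const (ε ^ 2)).log (hpos s)).neg
    refine h.congr_deriv ?_
    simp only [id, Pi.pow_apply]
    ring

/-- The Sokhotski-Plemelj formula for the average of the boundary values of a Stieltjes
transform. -/
lemma tendsto_stieltjes_add_stieltjes {f : ℝ → ℂ} {y : ℝ} (hy0 : 0 < y) (hy1 : y < 1)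
    (hf : IntegrableOn f (Ioc 0 1))
    (hs : IntegrableOn (fun s : ℝ => (f s - f y) / (y - s)) (Ioc 0 1)) :
    Tendsto (fun ε : ℝ => (∫ s in Ioc (0 : ℝ) 1, f s / ((y : ℂ) + ε * Complex.I - s))
        + ∫ s in Ioc (0 : ℝ) 1, f s / ((y : ℂ) - ε * Complex.I - s)) (𝓝[>] 0)
      (𝓝 (2 * ((∫ s in Ioc 0 1, (f s - f y) / (y - s)) + f y * Real.log (y / (1 - y))))) := by
  -- The sum of the Cauchy kernels at `y ± iε`. Writing `f` as `(f - f y) + f y` splits the integral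
  -- into one with dominated convergence and one that is an explicit logarithm.
  let K : ℝ → ℝ → ℝ := fun ε s => 2 * (y - s) / ((y - s) ^ 2 + ε ^ 2)
  have hden : ∀ (ε : ℝ) (s : ℝ), 0 < ε → ε ≤ ‖(y : ℂ) + ε * Complex.I - s‖ ∧
      ε ≤ ‖(y : ℂ) - ε * Complex.I - s‖ := by
    intro ε s h
    constructor
    · refine le_trans ?_ (Complex.abs_im_le_norm _)
      simp [le_abs_self]
    · refine le_trans ?_ (Complex.abs_im_le_norm _)
      simp [le_abs_self]
  have hint : ∀ (z : ℂ) (ε : ℝ), 0 < ε → (∀ s : ℝ, ε ≤ ‖z - s‖) →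
      IntegrableOn (fun s : ℝ => f s / (z - s)) (Ioc 0 1) := by
    intro z ε h hz
    simp only [div_eq_mul_inv]
    refine Integrable.mul_bdd (c := ε⁻¹) hf (by fun_prop) (Eventually.of_forall fun s => ?_)
    rw [norm_inv]
    exact inv_anti₀ h (hz s)
  have hKcont : ∀ ε : ℝ, 0 < ε → Continuous (K ε) := by
    intro ε h
    have hpos : ∀ s : ℝ, (y - s) ^ 2 + ε ^ 2 ≠ 0 := fun s => by positivity
    simp only [K]
    fun_prop (disch := exact hpos _)
  have hq : ∀ (ε s : ℝ), ‖((2 * (y - s) ^ 2 / ((y - s) ^ 2 + ε ^ 2) : ℝ) : ℂ)‖ ≤ 2 := by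
    intro ε s
    rw [Complex.norm_real, Real.norm_of_nonneg (by positivity)]
    exact div_le_of_le_mul₀ (by positivity) (by norm_num) (by nlinarith [sq_nonneg ε])
  -- Against the difference quotient the kernel becomes a factor bounded by `2` and tending to `2`
  -- off `s = y`.
  have hlim1 : Tendsto (fun ε : ℝ => ∫ s in Ioc (0 : ℝ) 1, (f s - f y) / ((y : ℂ) - s)
      * ((2 * (y - s) ^ 2 / ((y - s) ^ 2 + ε ^ 2) : ℝ) : ℂ)) (𝓝[>] 0)
      (𝓝 (∫ s in Ioc (0 : ℝ) 1, (f s - f y) / ((y : ℂ) - s) * 2)) := by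
    refine tendsto_integral_filter_of_dominated_convergence
      (fun s => ‖(f s - f y) / ((y : ℂ) - s)‖ * 2) ?_ ?_ (hs.norm.mul_const 2) ?_
    · refine Eventually.of_forall fun ε => hs.aestronglyMeasurable.mul ?_
      exact (Measurable.aestronglyMeasurable (by fun_prop))
    · refine Eventually.of_forall fun ε => Eventually.of_forall fun s => ?_
      rw [norm_mul]
      gcongr
      exact hq ε s
    · have hne : ∀ᵐ s ∂(volume.restrict (Ioc (0 : ℝ) 1)), s ≠ y :=
        ae_restrict_of_ae (by simp [ae_iff, measure_singleton])
      filter_upwards [hne] with s hsy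
      refine Tendsto.const_mul _ ?_
      have hsy2 : (y - s) ^ 2 ≠ 0 := pow_ne_zero 2 (sub_ne_zero.mpr hsy.symm)
      have : Tendsto (fun ε : ℝ => 2 * (y - s) ^ 2 / ((y - s) ^ 2 + ε ^ 2)) (𝓝 0)
          (𝓝 (2 * (y - s) ^ 2 / ((y - s) ^ 2 + 0 ^ 2))) := by
        refine Tendsto.div tendsto_const_nhds (tendsto_const_nhds.add (tendsto_id.pow 2)) ?_
        simpa using hsy2
      have e : 2 * (y - s) ^ 2 / ((y - s) ^ 2 + 0 ^ 2) = 2 := by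
        field_simp; ring
      rw [e] at this
      exact_mod_cast (Complex.continuous_ofReal.tendsto 2).comp (this.mono_left nhdsWithin_le_nhds)
  have hlim2 : Tendsto (fun ε : ℝ => f y * ((Real.log (y ^ 2 + ε ^ 2)
      - Real.log ((1 - y) ^ 2 + ε ^ 2) : ℝ) : ℂ)) (𝓝[>] 0)
      (𝓝 (f y * ((Real.log (y ^ 2 + 0 ^ 2) - Real.log ((1 - y) ^ 2 + 0 ^ 2) : ℝ) : ℂ))) := by
    refine Tendsto.const_mul _ ((Complex.continuous_ofReal.tendsto _).comp ?_)
    refine Tendsto.mono_left ?_ nhdsWithin_le_nhds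
    have h1 : y ^ 2 + 0 ^ 2 ≠ 0 := by positivity
    have h2 : (1 - y) ^ 2 + 0 ^ 2 ≠ 0 := by
      have : 0 < 1 - y := by linarith
      positivity
    exact ((tendsto_const_nhds.add (tendsto_id.pow 2)).log h1).sub
      ((tendsto_const_nhds.add (tendsto_id.pow 2)).log h2)
  have htot := hlim1.add hlim2
  rw [integral_mul_const] at htot
  have e : (∫ s in Ioc (0 : ℝ) 1, (f s - f y) / ((y : ℂ) - s)) * 2
      + f y * ((Real.log (y ^ 2 + 0 ^ 2) - Real.log ((1 - y) ^ 2 + 0 ^ 2) : ℝ) : ℂ)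
      = 2 * ((∫ s in Ioc 0 1, (f s - f y) / (y - s)) + f y * Real.log (y / (1 - y))) := by
    rw [Real.log_div hy0.ne' (by linarith)]
    simp only [ne_eq, OfNat.ofNat_ne_zero, not_false_eq_true, zero_pow, add_zero, Real.log_pow]
    push_cast
    ring
  rw [e] at htot
  refine htot.congr' ?_
  filter_upwards [self_mem_nhdsWithin] with ε (hε : 0 < ε)
  have i1 := hint _ ε hε fun s => (hden ε s hε).1
  have i2 := hint _ ε hε fun s => (hden ε s hε).2
  have iK : IntegrableOn (fun s : ℝ => f y * (K ε s : ℂ)) (Ioc 0 1) :=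
    (((Complex.continuous_ofReal.comp (hKcont ε hε)).integrableOn_Icc).mono_set
      Ioc_subset_Icc_self).const_mul _
  have iq : IntegrableOn (fun s : ℝ => (f s - f y) / ((y : ℂ) - s)
      * ((2 * (y - s) ^ 2 / ((y - s) ^ 2 + ε ^ 2) : ℝ) : ℂ)) (Ioc 0 1) := by
    refine Integrable.mul_bdd (c := 2) hs (Measurable.aestronglyMeasurable (by fun_prop))
      (Eventually.of_forall (hq ε))
  rw [← integral_add i1 i2, ← integral_poisson_conj y hε, ← intervalIntegral.integral_ofReal,
    intervalIntegral.integral_of_le zero_le_one, ← integral_const_mul, ← integral_add iq iK]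
  refine setIntegral_congr_fun measurableSet_Ioc fun s _ => ?_
  have n1 : (y : ℂ) + ε * Complex.I - s ≠ 0 :=
    norm_pos_iff.mp (hε.trans_le (hden ε s hε).1)
  have n2 : (y : ℂ) - ε * Complex.I - s ≠ 0 :=
    norm_pos_iff.mp (hε.trans_le (hden ε s hε).2)
  have e3 : ((y : ℂ) - s) ^ 2 + ε ^ 2
      = ((y : ℂ) + ε * Complex.I - s) * ((y : ℂ) - ε * Complex.I - s) := by
    linear_combination (ε : ℂ) ^ 2 * Complex.I_sq
  simp only [K]
  push_cast
  rw [e3]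
  rcases eq_or_ne s y with rfl | hsy
  · simp [add_sub_cancel_left, sub_sub_cancel_left, div_neg]
  · have n3 : (y : ℂ) - s ≠ 0 := sub_ne_zero.mpr (by exact_mod_cast hsy.symm)
    field_simp
    ring

/-! ### Vanishing moments of the Legendre function -/

/-- The recursion for the moments of the Legendre function, from Legendre's equation. -/
lemma sq_mul_integral_cpow_mul_legP (ν : ℂ) {σ : ℂ} (hσ : 0 < σ.re) :
    σ ^ 2 * ∫ s in Ioc (0 : ℝ) 1, (s : ℂ) ^ (σ - 1) * legP ν s
      = (σ * (σ + 1) - ν * (ν + 1)) * ∫ s in Ioc (0 : ℝ) 1, (s : ℂ) ^ σ * legP ν s := by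
  -- The boundary term of integrating Legendre's equation against `s ^ σ` by parts twice: in its
  -- derivative the terms with `legP'` cancel. It vanishes at `0` because `Re σ > 0`, and at `1`
  -- through the factor `1 - s`.
  let Φ : ℝ → ℂ := fun s => (s : ℂ) ^ σ * (s * (1 - s) * legP' ν s)
    - σ * (s : ℂ) ^ σ * (1 - s) * legP ν s
  have i1 := integrableOn_cpow_mul_legP ν (σ := σ - 1) (by simpa using hσ)
  have i2 := integrableOn_cpow_mul_legP ν (σ := σ) (by linarith)
  have hder : ∀ s ∈ Ioo (0 : ℝ) 1, HasDerivAt Φ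
      ((σ * (σ + 1) - ν * (ν + 1)) * ((s : ℂ) ^ σ * legP ν s)
        - σ ^ 2 * ((s : ℂ) ^ (σ - 1) * legP ν s)) s := by
    intro s hs
    have h1 := hasDerivAt_ofReal_cpow_const_of_pos hs.1 σ
    have h2 := hasDerivAt_mul_legP' ν hs.1 hs.2
    have h3 := hasDerivAt_legP ν hs.1 hs.2.le
    have h4 : HasDerivAt (fun t : ℝ => (1 : ℂ) - t) (-1) s := by
      simpa using ((hasDerivAt_id s).ofReal_comp).const_sub (1 : ℂ)
    refine ((h1.mul h2).sub (((h1.const_mul σ).mul h4).mul h3)).congr_deriv ?_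
    have hp : (s : ℂ) ^ σ = s ^ (σ - 1) * s := by
      rw [Complex.cpow_sub _ _ (by exact_mod_cast hs.1.ne'), Complex.cpow_one,
        div_mul_cancel₀ _ (by exact_mod_cast hs.1.ne')]
    simp only [Pi.mul_apply]
    rw [hp]
    ring
  have hlim0 : Tendsto Φ (𝓝[>] 0) (𝓝 0) := by
    set M := ‖ν * (ν + 1)‖
    set δ := σ.re / 2
    have hδ : 0 < δ := half_pos hσ
    have hpow : ∀ a : ℝ, 0 < a → Tendsto (fun s : ℝ => s ^ a) (𝓝[>] 0) (𝓝 0) := by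
      intro a ha
      have := (Real.continuousAt_rpow_const 0 a (Or.inr ha.le)).tendsto
      rw [Real.zero_rpow ha.ne'] at this
      exact this.mono_left nhdsWithin_le_nhds
    have hb := ((hpow σ.re hσ).const_mul (M * Real.exp M)).add
      ((hpow δ hδ).const_mul (‖σ‖ * (1 + M * Real.exp M / δ)))
    rw [mul_zero, mul_zero, add_zero] at hb
    refine squeeze_zero_norm' ?_ hb
    filter_upwards [Ioo_mem_nhdsGT (zero_lt_one' ℝ)] with s hs
    have e1 : s ^ σ.re * s ^ (-δ) = s ^ δ := by
      rw [← Real.rpow_add hs.1]; congr 1; simp only [δ]; ring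
    have h1 := norm_legP'_le (le_refl M) hs.1 hs.2.le
    have h2 := norm_legP_le_rpow (le_refl M) hδ hs.1 hs.2.le
    have h3 : ‖(1 : ℂ) - s‖ ≤ 1 := (norm_one_sub_ofReal_lt hs.1 hs.2.le).le
    have h4 : ‖(s : ℂ)‖ = s := by rw [Complex.norm_real, Real.norm_of_nonneg hs.1.le]
    have hs0 := hs.1
    calc ‖Φ s‖ ≤ s ^ σ.re * (s * 1 * (M * Real.exp M / s))
          + ‖σ‖ * s ^ σ.re * 1 * ((1 + M * Real.exp M / δ) * s ^ (-δ)) := by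
          refine (norm_sub_le _ _).trans ?_
          simp only [norm_mul, Complex.norm_cpow_eq_rpow_re_of_pos hs.1, h4]
          gcongr
      _ = _ := by
          rw [← e1]
          field_simp
  have hlim1 : Tendsto Φ (𝓝[<] 1) (𝓝 0) := by
    have hb : Tendsto (fun s : ℝ => (s : ℂ) ^ σ * (s * (1 - s) * legP' ν s)
        - σ * (s : ℂ) ^ σ * (1 - s) * legP ν s) (𝓝[<] 1) (𝓝 0) := by
      have c1 := (hasDerivAt_ofReal_cpow_const_of_pos one_pos σ).continuousAt.tendsto
      have c2 := (hasDerivAt_legP ν one_pos le_rfl).continuousAt.tendsto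
      have c4 : Tendsto (fun s : ℝ => (s : ℂ)) (𝓝 1) (𝓝 ((1 : ℝ) : ℂ)) :=
        Complex.continuous_ofReal.tendsto 1
      have c3 : ContinuousAt (legP' ν) 1 := by
        have h := hasDerivAt_powerSum
          (norm_succ_mul_legendreCoeff_succ_le (le_refl ‖ν * (ν + 1)‖))
          (norm_one_sub_ofReal_lt one_pos le_rfl)
        exact (((h.comp ((1 : ℝ) : ℂ)
          ((hasDerivAt_id ((1 : ℝ) : ℂ)).const_sub 1)).comp_ofReal).neg).continuousAt
      have c5 := c4.const_sub (1 : ℂ)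
      have := ((c1.mul ((c4.mul c5).mul c3.tendsto)).sub
        (((c1.const_mul σ).mul c5).mul c2)).mono_left
        (nhdsWithin_le_nhds (s := Iio 1))
      simpa using this
    exact hb
  have hint : IntervalIntegrable (fun s : ℝ => (σ * (σ + 1) - ν * (ν + 1)) * ((s : ℂ) ^ σ * legP ν s)
        - σ ^ 2 * ((s : ℂ) ^ (σ - 1) * legP ν s)) volume 0 1 :=
    (intervalIntegrable_iff_integrableOn_Ioc_of_le zero_le_one).mpr
      ((i2.const_mul _).sub (i1.const_mul _))
  have h := intervalIntegral.integral_eq_sub_of_hasDerivAt_of_tendsto zero_lt_one hder hint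
    hlim0 hlim1
  rw [intervalIntegral.integral_of_le zero_le_one,
    integral_sub (i2.const_mul _) (i1.const_mul _), integral_const_mul, integral_const_mul,
    sub_zero] at h
  linear_combination -h

/-- The recursion at `σ = ν` has right-hand factor zero, which kills the first moment; at `σ = ν -
(m + 1)` it passes the vanishing down, since `Re σ > 0` makes `σ ^ 2` nonzero. -/
lemma integral_cpow_mul_legP_eq_zero (ν : ℂ) (m : ℕ) (h : -1 < (ν - ((m + 1 : ℕ) : ℂ)).re) :
    ∫ s in Ioc (0 : ℝ) 1, (s : ℂ) ^ (ν - ((m + 1 : ℕ) : ℂ)) * legP ν s = 0 := by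
  induction m with
  | zero =>
    have hre : 0 < ν.re := by simpa using h
    have h1 := sq_mul_integral_cpow_mul_legP ν hre
    rw [sub_self, zero_mul] at h1
    have hν : ν ≠ 0 := by rintro rfl; simp at hre
    simpa using (mul_eq_zero.mp h1).resolve_left (pow_ne_zero 2 hν)
  | succ m ih =>
    have hre : 0 < (ν - ((m + 1 : ℕ) : ℂ)).re := by
      simp at h ⊢
      linarith
    have h1 := sq_mul_integral_cpow_mul_legP ν hre
    rw [ih (by linarith), mul_zero] at h1
    have hν : ν - ((m + 1 : ℕ) : ℂ) ≠ 0 := by intro h0; rw [h0] at hre; simp at hre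
    have h2 := (mul_eq_zero.mp h1).resolve_left (pow_ne_zero 2 hν)
    rw [sub_sub, ← Nat.cast_add_one] at h2
    exact h2

/-! ### Beta function, Euler's integral and Schläfli's integral -/

/-- The coefficients of the binomial series of `(1 - q) ^ (-a)`. -/
def risingCoeff (a : ℂ) (k : ℕ) : ℂ := (ascPochhammer ℂ k).eval a / k.factorial

lemma hasSum_risingCoeff (a : ℂ) {q : ℂ} (hq : ‖q‖ < 1) :
    HasSum (fun k => risingCoeff a k * q ^ k) ((1 - q) ^ (-a)) := by
  have h := (Complex.one_add_cpow_hasFPowerSeriesOnBall_zero (a := -a)).hasSum (y := -q)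
    (by
      rw [← ENNReal.ofReal_one, Metric.eball_ofReal]
      simpa using hq)
  rw [zero_add, ← sub_eq_add_neg] at h
  refine h.congr_fun fun k => ?_
  -- The binomial series is a hypergeometric series whose equal second and third parameters cancel;
  -- `1` is a convenient choice.
  rw [binomialSeries_eq_ordinaryHypergeometricSeries (b := (1 : ℂ)) (by norm_cast; simp), neg_neg,
    FormalMultilinearSeries.compContinuousLinearMap_apply]
  have hn : (k.factorial : ℂ) ≠ 0 := by exact_mod_cast k.factorial_ne_zero
  have := ordinaryHypergeometricSeries_apply_eq a 1 (1 : ℂ) q k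
  simp only [ascPochhammer_eval_one, smul_eq_mul] at this
  simp only [Function.comp_def, neg_apply, ContinuousLinearMap.id_apply, neg_neg]
  rw [this, risingCoeff]
  field_simp

lemma ascPochhammer_eval_mul_Gamma (z : ℂ) (hz : 0 < z.re) (k : ℕ) :
    Complex.Gamma (z + k) = (ascPochhammer ℂ k).eval z * Complex.Gamma z := by
  induction k with
  | zero => simp
  | succ k ih =>
    have h0 : z + k ≠ 0 := by
      intro h
      have := congrArg Complex.re h
      simp at this
      linarith [k.cast_nonneg (α := ℝ)]
    rw [Nat.cast_succ, ← add_assoc, Complex.Gamma_add_one _ h0, ih, ascPochhammer_succ_eval]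
    ring

/-- The value `B(ν + 1, -ν)` of the Beta function. -/
def betaLeg (ν : ℂ) : ℂ := Complex.betaIntegral (ν + 1) (-ν)

/-- The arguments of the Beta function sum to `1`, so it equals `Γ(ν + 1) Γ(-ν)`, and the reflection
formula applies. -/
lemma betaLeg_mul_sin {ν : ℂ} (h1 : -1 < ν.re) (h2 : ν.re < 0) :
    betaLeg ν * Complex.sin (ν * Real.pi) = -Real.pi := by
  have h := Complex.Gamma_mul_Gamma_eq_betaIntegral (s := ν + 1) (t := -ν) (by simp; linarith)
    (by simpa using h2)
  rw [add_neg_cancel_comm, Complex.Gamma_one, one_mul] at h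
  have h3 := Complex.Gamma_mul_Gamma_one_sub (-ν)
  rw [sub_neg_eq_add, add_comm 1 ν, mul_comm, h, mul_neg, Complex.sin_neg, mul_comm (Real.pi : ℂ)]
    at h3
  have hs : Complex.sin (ν * Real.pi) ≠ 0 := by
    rw [Complex.sin_ne_zero_iff]
    intro k hk
    have hk' : ν = k := mul_right_cancel₀ (by exact_mod_cast Real.pi_ne_zero) hk
    rw [hk', Complex.intCast_re] at h1 h2
    have a1 : (-1 : ℤ) < k := by exact_mod_cast h1
    have a2 : k < 0 := by exact_mod_cast h2
    omega
  rw [betaLeg, h3, div_neg, neg_mul, div_mul_cancel₀ _ hs]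

lemma betaIntegral_add_nat {ν : ℂ} (h1 : -1 < ν.re) (h2 : ν.re < 0) (k : ℕ) :
    Complex.betaIntegral (ν + 1 + k) (-ν) = risingCoeff (ν + 1) k * betaLeg ν := by
  have hp : 0 < (ν + 1).re := by simp; linarith
  have hn : 0 < (-ν).re := by simpa using h2
  have e1 := Complex.Gamma_mul_Gamma_eq_betaIntegral (s := ν + 1 + k) (t := -ν)
    (by simp at hp ⊢; linarith [k.cast_nonneg (α := ℝ)]) hn
  have e2 := Complex.Gamma_mul_Gamma_eq_betaIntegral hp hn
  rw [add_neg_cancel_comm, Complex.Gamma_one, one_mul] at e2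
  rw [show ν + 1 + k + -ν = (k : ℂ) + 1 by ring, Complex.Gamma_nat_eq_factorial,
    ascPochhammer_eval_mul_Gamma _ hp, mul_assoc, e2] at e1
  have hf : (k.factorial : ℂ) ≠ 0 := by exact_mod_cast k.factorial_ne_zero
  rw [risingCoeff, betaLeg, div_mul_eq_mul_div, eq_div_iff hf, mul_comm, e1]

/-- The weight `τ ^ ν * (1 - τ) ^ (-ν - 1)` of Euler's integral. -/
def eulerWeight (ν : ℂ) (τ : ℝ) : ℂ := (τ : ℂ) ^ ν * (1 - (τ : ℂ)) ^ (-ν - 1)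

lemma integrableOn_eulerWeight {ν : ℂ} (h1 : -1 < ν.re) (h2 : ν.re < 0) :
    IntegrableOn (eulerWeight ν) (Ioc 0 1) := by
  have h := Complex.betaIntegral_convergent (u := ν + 1) (v := -ν) (by simp; linarith)
    (by simpa using h2)
  rw [add_sub_cancel_right] at h
  exact (intervalIntegrable_iff_integrableOn_Ioc_of_le zero_le_one).mp h

lemma integral_eulerWeight_mul_pow {ν : ℂ} (h1 : -1 < ν.re) (h2 : ν.re < 0) (k : ℕ) :
    ∫ τ in Ioc (0 : ℝ) 1, eulerWeight ν τ * (τ : ℂ) ^ k = risingCoeff (ν + 1) k * betaLeg ν := by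
  rw [← betaIntegral_add_nat h1 h2, Complex.betaIntegral,
    intervalIntegral.integral_of_le zero_le_one]
  refine setIntegral_congr_fun measurableSet_Ioc fun τ hτ => ?_
  have hτ0 : (τ : ℂ) ≠ 0 := by exact_mod_cast hτ.1.ne'
  simp only [eulerWeight]
  rw [show ν + 1 + k - 1 = ν + k by ring, Complex.cpow_add _ _ hτ0, Complex.cpow_natCast]
  ring

/-- Termwise integration of a power series against Euler's weight. -/
lemma hasSum_integral_eulerWeight {ν : ℂ} (h1 : -1 < ν.re) (h2 : ν.re < 0) {a : ℕ → ℂ} {q : ℂ}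
    (ha : Summable fun k => a k * q ^ k) :
    HasSum (fun k => a k * q ^ k * (risingCoeff (ν + 1) k * betaLeg ν))
      (∫ τ in Ioc (0 : ℝ) 1, ∑' k, a k * q ^ k * (eulerWeight ν τ * (τ : ℂ) ^ k)) := by
  have hW := integrableOn_eulerWeight h1 h2
  have hbd : ∀ k : ℕ, ∀ τ ∈ Ioc (0 : ℝ) 1, ‖(τ : ℂ) ^ k‖ ≤ 1 := by
    intro k τ hτ
    rw [norm_pow, Complex.norm_real, Real.norm_of_nonneg hτ.1.le]
    exact pow_le_one₀ hτ.1.le hτ.2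
  have hWk : ∀ k : ℕ, IntegrableOn (fun τ : ℝ => eulerWeight ν τ * (τ : ℂ) ^ k) (Ioc 0 1) := by
    intro k
    refine Integrable.mul_bdd (c := 1) hW (by fun_prop) ?_
    filter_upwards [ae_restrict_mem measurableSet_Ioc] with τ hτ using hbd k τ hτ
  have h := hasSum_integral_of_summable_integral_norm
    (F := fun k (τ : ℝ) => a k * q ^ k * (eulerWeight ν τ * (τ : ℂ) ^ k))
    (μ := volume.restrict (Ioc 0 1)) (fun k => (hWk k).const_mul _) ?_
  · simp only [integral_const_mul, integral_eulerWeight_mul_pow h1 h2] at h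
    exact h
  · refine Summable.of_nonneg_of_le (fun k => by positivity) (fun k => ?_)
      (ha.norm.mul_right (∫ τ in Ioc (0 : ℝ) 1, ‖eulerWeight ν τ‖))
    simp only [norm_mul _ (eulerWeight ν _ * _)]
    rw [integral_const_mul]
    refine mul_le_mul_of_nonneg_left ?_ (norm_nonneg _)
    refine setIntegral_mono_on (hWk k).norm hW.norm measurableSet_Ioc fun τ hτ => ?_
    rw [norm_mul]
    exact mul_le_of_le_one_right (norm_nonneg _) (hbd k τ hτ)

lemma norm_mul_ofReal_lt_one {q : ℂ} (hq : ‖q‖ < 1) {τ : ℝ} (hτ : τ ∈ Ioc (0 : ℝ) 1) :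
    ‖q * τ‖ < 1 := by
  rw [norm_mul, Complex.norm_real, Real.norm_of_nonneg hτ.1.le]
  nlinarith [norm_nonneg q, hτ.1, hτ.2]

/-- Euler's integral for the Legendre function. -/
lemma integral_eulerWeight_mul_cpow {ν : ℂ} (h1 : -1 < ν.re) (h2 : ν.re < 0) {q : ℂ}
    (hq : ‖q‖ < 1) :
    ∫ τ in Ioc (0 : ℝ) 1, eulerWeight ν τ * (1 - q * τ) ^ ν
      = betaLeg ν * powerSum (legendreCoeff ν) q := by
  have h := hasSum_integral_eulerWeight h1 h2 (hasSum_risingCoeff (-ν) hq).summable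
  have e : ∫ τ in Ioc (0 : ℝ) 1, ∑' k, risingCoeff (-ν) k * q ^ k * (eulerWeight ν τ * (τ : ℂ) ^ k)
      = ∫ τ in Ioc (0 : ℝ) 1, eulerWeight ν τ * (1 - q * τ) ^ ν := by
    refine setIntegral_congr_fun measurableSet_Ioc fun τ hτ => ?_
    have := (hasSum_risingCoeff (-ν) (norm_mul_ofReal_lt_one hq hτ)).tsum_eq
    rw [neg_neg] at this
    rw [← this, ← tsum_mul_left]
    exact tsum_congr fun k => by ring
  rw [← e, ← h.tsum_eq, powerSum, ← tsum_mul_left]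
  refine tsum_congr fun k => ?_
  simp only [legendreCoeff, ordinaryHypergeometricCoefficient, risingCoeff, ascPochhammer_eval_one]
  ring

/-- The Stieltjes transform of Euler's weight inside the unit disc. -/
lemma integral_eulerWeight_mul_inv_of_norm_lt_one {ν : ℂ} (h1 : -1 < ν.re) (h2 : ν.re < 0) {q : ℂ}
    (hq : ‖q‖ < 1) :
    ∫ τ in Ioc (0 : ℝ) 1, eulerWeight ν τ * (1 - q * τ)⁻¹
      = betaLeg ν * (1 - q) ^ (-ν - 1) := by
  have h := hasSum_integral_eulerWeight h1 h2 (a := fun _ => 1) (q := q)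
    (by simpa using summable_geometric_of_norm_lt_one hq)
  have e : ∫ τ in Ioc (0 : ℝ) 1, ∑' k, 1 * q ^ k * (eulerWeight ν τ * (τ : ℂ) ^ k)
      = ∫ τ in Ioc (0 : ℝ) 1, eulerWeight ν τ * (1 - q * τ)⁻¹ := by
    refine setIntegral_congr_fun measurableSet_Ioc fun τ hτ => ?_
    rw [← (hasSum_geometric_of_norm_lt_one (norm_mul_ofReal_lt_one hq hτ)).tsum_eq, ← tsum_mul_left]
    exact tsum_congr fun k => by ring
  rw [← e, ← h.tsum_eq, show -ν - 1 = -(ν + 1) by ring, ← (hasSum_risingCoeff (ν + 1) hq).tsum_eq,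
    ← tsum_mul_left]
  exact tsum_congr fun k => by ring

lemma one_sub_mul_ofReal_mem_slitPlane {q : ℂ} (hq : 1 - q ∈ Complex.slitPlane) {τ : ℝ}
    (h0 : 0 ≤ τ) (h1 : τ ≤ 1) : 1 - q * τ ∈ Complex.slitPlane := by
  have := Complex.starConvex_one_slitPlane hq (sub_nonneg.mpr h1) h0 (sub_add_cancel 1 τ)
  convert this using 1
  simp only [Complex.real_smul]
  push_cast
  ring

/-- The Stieltjes transform of Euler's weight. -/
lemma integral_eulerWeight_mul_inv {ν : ℂ} (h1 : -1 < ν.re) (h2 : ν.re < 0) {q : ℂ}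
    (hq : 1 - q ∈ Complex.slitPlane) :
    ∫ τ in Ioc (0 : ℝ) 1, eulerWeight ν τ * (1 - q * τ)⁻¹
      = betaLeg ν * (1 - q) ^ (-ν - 1) := by
  -- Both sides are holomorphic in `q` on this region, which is star-shaped about `0`, and they
  -- agree on the unit disc.
  let U : Set ℂ := {q | 1 - q ∈ Complex.slitPlane}
  have hW := integrableOn_eulerWeight h1 h2
  have hU : IsOpen U := Complex.isOpen_slitPlane.preimage (by fun_prop)
  have hU0 : (0 : ℂ) ∈ U := by simp [U]
  have hUc : IsPreconnected U := by
    have hs : StarConvex ℝ 0 U := by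
      intro z hz a b ha hb hab
      have := one_sub_mul_ofReal_mem_slitPlane (show 1 - z ∈ Complex.slitPlane from hz) hb
        (by linarith)
      simpa [U, mul_comm] using this
    exact (hs.isPathConnected hU0).isConnected.isPreconnected
  have hL : DifferentiableOn ℂ (fun q : ℂ => ∫ τ in Ioc (0 : ℝ) 1, eulerWeight ν τ * (1 - q * (τ : ℂ))⁻¹)
      U := by
    refine differentiableOn_integral_of_dominated hU
      (fun z _ => hW.aestronglyMeasurable.mul
        (Measurable.aestronglyMeasurable (by fun_prop))) ?_ fun z₀ hz₀ => ?_
    · filter_upwards [ae_restrict_mem measurableSet_Ioc] with τ hτ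
      refine DifferentiableOn.const_mul (DifferentiableOn.inv (by fun_prop) fun z hz => ?_) _
      exact Complex.slitPlane_ne_zero (one_sub_mul_ofReal_mem_slitPlane hz hτ.1.le hτ.2)
    · obtain ⟨r, hr, hrU⟩ := Metric.nhds_basis_closedBall.mem_iff.mp (hU.mem_nhds hz₀)
      obtain ⟨C, hC⟩ := ((isCompact_closedBall z₀ r).prod
        (isCompact_Icc (a := (0 : ℝ)) (b := 1))).exists_bound_of_continuousOn
        (f := fun p : ℂ × ℝ => (1 - p.1 * p.2)⁻¹) (by
          refine ContinuousOn.inv₀ (by fun_prop) fun p hp => ?_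
          exact Complex.slitPlane_ne_zero
            (one_sub_mul_ofReal_mem_slitPlane (hrU hp.1) hp.2.1 hp.2.2))
      refine ⟨_, Metric.closedBall_mem_nhds z₀ hr, fun τ => ‖eulerWeight ν τ‖ * C,
        hW.norm.mul_const C, ?_⟩
      filter_upwards [ae_restrict_mem measurableSet_Ioc] with τ hτ z hz
      rw [norm_mul]
      gcongr
      exact hC (z, τ) ⟨hz, Ioc_subset_Icc_self hτ⟩
  have hR : DifferentiableOn ℂ (fun q => betaLeg ν * (1 - q) ^ (-ν - 1)) U := by
    intro z hz
    have : DifferentiableAt ℂ (fun q : ℂ => 1 - q) z := by fun_prop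
    exact ((this.cpow_const (c := -ν - 1) hz).const_mul _).differentiableWithinAt
  refine (hL.analyticOnNhd hU).eqOn_of_preconnected_of_eventuallyEq (hR.analyticOnNhd hU) hUc hU0
    ?_ hq
  filter_upwards [Metric.ball_mem_nhds (0 : ℂ) one_pos] with z hz
  exact integral_eulerWeight_mul_inv_of_norm_lt_one h1 h2 (by simpa using hz)

/-- The integrand `(r (1 - r)) ^ ν * |y - r| ^ (-ν - 1)` of Schläfli's integral. -/
def schlaefli (ν : ℂ) (y r : ℝ) : ℂ :=
  (r : ℂ) ^ ν * (1 - (r : ℂ)) ^ ν * ((|y - r| : ℝ) : ℂ) ^ (-ν - 1)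

lemma schlaefli_one_sub (ν : ℂ) (y r : ℝ) : schlaefli ν y (1 - r) = schlaefli ν (1 - y) r := by
  have : |y - (1 - r)| = |1 - y - r| := by rw [← abs_neg]; ring_nf
  rw [schlaefli, schlaefli, this]
  push_cast
  rw [sub_sub_cancel]
  ring

/-- The substitution `r = 1 - (1 - y) τ` turns Schläfli's integrand on `(y, 1)` into Euler's; the
prefactor is what `dr` will cancel. -/
lemma schlaefli_eq_eulerWeight (ν : ℂ) {y τ : ℝ} (hy : y < 1) (hτ : τ ∈ Ioc (0 : ℝ) 1) :
    schlaefli ν y (1 - (1 - y) * τ)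
      = ((1 - y : ℝ) : ℂ)⁻¹ * (eulerWeight ν τ * (1 - (1 - (y : ℂ)) * τ) ^ ν) := by
  have hy' : 0 < 1 - y := by linarith
  have hyc : ((1 - y : ℝ) : ℂ) ≠ 0 := by exact_mod_cast hy'.ne'
  have e1 : |y - (1 - (1 - y) * τ)| = (1 - y) * (1 - τ) := by
    rw [abs_of_nonpos] <;> nlinarith [hτ.2]
  have e2 : (1 : ℂ) - ((1 - (1 - y) * τ : ℝ) : ℂ) = ((1 - y : ℝ) : ℂ) * (τ : ℂ) := by
    push_cast; ring
  have e3 : ((1 - y : ℝ) : ℂ)⁻¹ = ((1 - y : ℝ) : ℂ) ^ ν * ((1 - y : ℝ) : ℂ) ^ (-ν - 1) := by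
    rw [← Complex.cpow_add _ _ hyc, show ν + (-ν - 1) = -1 by ring, Complex.cpow_neg_one]
  rw [schlaefli, e1, e2, e3, Complex.mul_cpow_ofReal_nonneg hy'.le hτ.1.le, Complex.ofReal_mul,
    Complex.mul_cpow_ofReal_nonneg hy'.le (by linarith [hτ.2]), eulerWeight]
  push_cast
  ring

lemma integrableOn_eulerWeight_mul_cpow {ν : ℂ} (h1 : -1 < ν.re) (h2 : ν.re < 0) {q : ℂ}
    (hq : ‖q‖ < 1) : IntegrableOn (fun τ : ℝ => eulerWeight ν τ * (1 - q * τ) ^ ν) (Ioc 0 1) := by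
  have hc : ContinuousOn (fun τ : ℝ => (1 - q * (τ : ℂ)) ^ ν) (Icc 0 1) := by
    refine ContinuousOn.cpow (by fun_prop) (by fun_prop) fun τ hτ => ?_
    refine one_sub_mul_ofReal_mem_slitPlane ?_ hτ.1 hτ.2
    have := Complex.mem_slitPlane_of_norm_lt_one (z := -q) (by simpa using hq)
    rwa [← sub_eq_add_neg] at this
  have h := (Iff.mpr integrableOn_Icc_iff_integrableOn_Ioc
    (integrableOn_eulerWeight h1 h2)).mul_continuousOn hc isCompact_Icc
  exact h.mono_set Ioc_subset_Icc_self

lemma intervalIntegrable_schlaefli_right {ν : ℂ} (h1 : -1 < ν.re) (h2 : ν.re < 0) {y : ℝ}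
    (hy0 : 0 < y) (hy1 : y < 1) : IntervalIntegrable (schlaefli ν y) volume y 1 := by
  have hy' : 1 - y ≠ 0 := by linarith
  have hg := (integrableOn_eulerWeight_mul_cpow h1 h2 (norm_one_sub_ofReal_lt hy0 hy1.le)).const_mul
    ((1 - y : ℝ) : ℂ)⁻¹
  have hg' : IntervalIntegrable (fun τ : ℝ => schlaefli ν y (1 - (1 - y) * τ)) volume 0 1 := by
    refine (intervalIntegrable_iff_integrableOn_Ioc_of_le zero_le_one).mpr ?_
    exact IntegrableOn.congr_fun hg (fun τ hτ => (schlaefli_eq_eulerWeight ν hy1 hτ).symm)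
      measurableSet_Ioc
  have h3 := (hg'.comp_mul_left (c := (1 - y)⁻¹) (by simp) (by simp)).comp_sub_left 1 (by simp)
  convert h3.symm using 1
  · ext r
    rw [mul_inv_cancel_left₀ hy', sub_sub_cancel]
  · simp
  · simp

lemma integral_schlaefli_right {ν : ℂ} (h1 : -1 < ν.re) (h2 : ν.re < 0) {y : ℝ}
    (hy0 : 0 < y) (hy1 : y < 1) : ∫ r in y..1, schlaefli ν y r = betaLeg ν * legP ν y := by
  have hy' : 1 - y ≠ 0 := by linarith
  have hyc : ((1 - y : ℝ) : ℂ) ≠ 0 := by exact_mod_cast hy'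
  have h := intervalIntegral.integral_comp_sub_mul (a := 0) (b := 1) (schlaefli ν y) hy' 1
  rw [mul_one, mul_zero, sub_sub_cancel, sub_zero, Complex.real_smul,
    intervalIntegral.integral_of_le zero_le_one,
    setIntegral_congr_fun measurableSet_Ioc fun τ hτ => schlaefli_eq_eulerWeight ν hy1 hτ,
    integral_const_mul,
    integral_eulerWeight_mul_cpow h1 h2 (norm_one_sub_ofReal_lt hy0 hy1.le),
    Complex.ofReal_inv] at h
  exact (mul_left_cancel₀ (inv_ne_zero hyc) h).symm

lemma intervalIntegrable_schlaefli_left {ν : ℂ} (h1 : -1 < ν.re) (h2 : ν.re < 0) {y : ℝ}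
    (hy0 : 0 < y) (hy1 : y < 1) : IntervalIntegrable (schlaefli ν y) volume 0 y := by
  have h := (intervalIntegrable_schlaefli_right h1 h2 (y := 1 - y) (by linarith)
    (by linarith)).comp_sub_left 1 (by simp)
  rw [sub_sub_cancel, sub_self] at h
  convert h.symm using 1
  ext r
  rw [schlaefli_one_sub, sub_sub_cancel]

/-- The reflection `r ↦ 1 - r` exchanges `y` with `1 - y`, which is where `P_ν(-x)` enters. -/
lemma integral_schlaefli_left {ν : ℂ} (h1 : -1 < ν.re) (h2 : ν.re < 0) {y : ℝ}
    (hy0 : 0 < y) (hy1 : y < 1) :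
    ∫ r in (0 : ℝ)..y, schlaefli ν y r = betaLeg ν * legP ν (1 - y) := by
  have h := intervalIntegral.integral_comp_sub_left (a := 1 - y) (b := 1) (schlaefli ν y) 1
  simp only [schlaefli_one_sub, sub_self, sub_sub_cancel] at h
  rw [← h, integral_schlaefli_right h1 h2 (by linarith) (by linarith)]

lemma cpow_mul_abs_cpow_eq_eulerWeight (ν : ℂ) {r σ : ℝ} (hr : 0 < r) (hσ : σ ∈ Ioc (0 : ℝ) 1) :
    ((r * σ : ℝ) : ℂ) ^ ν * ((|r * σ - r| : ℝ) : ℂ) ^ (-ν - 1) = (r : ℂ)⁻¹ * eulerWeight ν σ := by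
  have hrc : (r : ℂ) ≠ 0 := by exact_mod_cast hr.ne'
  have e1 : |r * σ - r| = r * (1 - σ) := by
    rw [abs_of_nonpos] <;> nlinarith [hσ.2]
  have e3 : (r : ℂ)⁻¹ = (r : ℂ) ^ ν * (r : ℂ) ^ (-ν - 1) := by
    rw [← Complex.cpow_add _ _ hrc, show ν + (-ν - 1) = -1 by ring, Complex.cpow_neg_one]
  rw [e1, e3, Complex.ofReal_mul, Complex.ofReal_mul,
    Complex.mul_cpow_ofReal_nonneg hr.le hσ.1.le,
    Complex.mul_cpow_ofReal_nonneg hr.le (by linarith [hσ.2]), eulerWeight]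
  push_cast
  ring

/-- The rescaling `s = r σ` in integrals of `s ^ ν * (r - s) ^ (-ν - 1) * f s` over `(0, r)`. -/
lemma integral_cpow_mul_abs_cpow {E : Type*} [NormedAddCommGroup E] [NormedSpace ℝ E]
    (ν : ℂ) {r : ℝ} (hr : 0 < r) (F : ℝ → ℂ → E) :
    ∫ s in Ioc 0 r, F s ((s : ℂ) ^ ν * ((|s - r| : ℝ) : ℂ) ^ (-ν - 1))
      = r • ∫ σ in Ioc (0 : ℝ) 1, F (r * σ) ((r : ℂ)⁻¹ * eulerWeight ν σ) := by
  have h := intervalIntegral.smul_integral_comp_mul_left (a := 0) (b := 1)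
    (fun s : ℝ => F s ((s : ℂ) ^ ν * ((|s - r| : ℝ) : ℂ) ^ (-ν - 1))) r
  rw [mul_zero, mul_one, intervalIntegral.integral_of_le zero_le_one,
    intervalIntegral.integral_of_le hr.le] at h
  rw [← h]
  congr 1
  refine setIntegral_congr_fun measurableSet_Ioc fun σ hσ => ?_
  rw [cpow_mul_abs_cpow_eq_eulerWeight ν hr hσ]

lemma integrableOn_cpow_mul_abs_cpow {ν : ℂ} (h1 : -1 < ν.re) (h2 : ν.re < 0) {r : ℝ}
    (hr : 0 < r) :
    IntegrableOn (fun s : ℝ => (s : ℂ) ^ ν * ((|s - r| : ℝ) : ℂ) ^ (-ν - 1)) (Ioc 0 r) := by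
  have hg : IntervalIntegrable (fun σ : ℝ => ((r * σ : ℝ) : ℂ) ^ ν
      * ((|r * σ - r| : ℝ) : ℂ) ^ (-ν - 1)) volume 0 1 := by
    refine (intervalIntegrable_iff_integrableOn_Ioc_of_le zero_le_one).mpr ?_
    exact IntegrableOn.congr_fun ((integrableOn_eulerWeight h1 h2).const_mul (r : ℂ)⁻¹)
      (fun σ hσ => (cpow_mul_abs_cpow_eq_eulerWeight ν hr hσ).symm) measurableSet_Ioc
  have h3 := hg.comp_mul_left (c := r⁻¹) enorm_ne_top enorm_ne_top
  simp only [mul_inv_cancel_left₀ hr.ne'] at h3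
  rw [zero_div, one_div, inv_inv] at h3
  exact (intervalIntegrable_iff_integrableOn_Ioc_of_le hr.le).mp h3

/-! ### The Stieltjes transform by exchange of integrals -/

/-- The kernel of the double integral computing the Stieltjes transform of `legF ν`. -/
def stieltjesKernel (ν ζ : ℂ) (p : ℝ × ℝ) : ℂ :=
  {p : ℝ × ℝ | p.1 < p.2}.indicator
    (fun p => (p.1 : ℂ) ^ ν * (ζ - p.1)⁻¹ * schlaefli ν p.1 p.2) p

lemma measurable_stieltjesKernel (ν ζ : ℂ) : Measurable (stieltjesKernel ν ζ) := by
  refine Measurable.indicator ?_ (measurableSet_lt measurable_fst measurable_snd)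
  unfold schlaefli
  fun_prop

lemma stieltjesKernel_left (ν ζ : ℂ) (s : ℝ) : (fun r => stieltjesKernel ν ζ (s, r))
    = (Ioi s).indicator fun r => (s : ℂ) ^ ν * (ζ - s)⁻¹ * schlaefli ν s r := by
  ext r
  simp [stieltjesKernel, indicator_apply]

lemma stieltjesKernel_right (ν ζ : ℂ) (r : ℝ) : (fun s => stieltjesKernel ν ζ (s, r))
    = (Iio r).indicator fun s => (s : ℂ) ^ ν * ((|s - r| : ℝ) : ℂ) ^ (-ν - 1) * (ζ - s)⁻¹
      * ((r : ℂ) ^ ν * (1 - (r : ℂ)) ^ ν) := by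
  ext s
  simp only [stieltjesKernel, indicator_apply, mem_ofPred_eq, mem_Iio, schlaefli]
  split_ifs
  · ring
  · rfl

lemma abs_im_le_norm_sub_ofReal (ζ : ℂ) (s : ℝ) : |ζ.im| ≤ ‖ζ - s‖ := by
  simpa using Complex.abs_im_le_norm (ζ - s)

lemma integrableOn_cpow_mul_one_sub_cpow {ν : ℂ} (h1 : -1 < ν.re) :
    IntegrableOn (fun r : ℝ => (r : ℂ) ^ ν * (1 - (r : ℂ)) ^ ν) (Ioc 0 1) := by
  have h := Complex.betaIntegral_convergent (u := ν + 1) (v := ν + 1) (by simp; linarith)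
    (by simp; linarith)
  simp only [add_sub_cancel_right] at h
  exact (intervalIntegrable_iff_integrableOn_Ioc_of_le zero_le_one).mp h

lemma Ioc_inter_Iio_of_le {r : ℝ} (hr : r ≤ 1) : Ioc (0 : ℝ) 1 ∩ Iio r = Ioo 0 r := by
  ext s
  simp only [mem_inter_iff, mem_Ioc, mem_Iio, mem_Ioo]
  constructor
  · rintro ⟨⟨a, b⟩, c⟩; exact ⟨a, c⟩
  · rintro ⟨a, b⟩; exact ⟨⟨a, by linarith⟩, b⟩

/-- Integrate the norm in `s` first. The factor `(ζ - s)⁻¹` is at most `|Im ζ|⁻¹`, and `s ^ ν * (r -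
s) ^ (-ν - 1)` is homogeneous of degree `-1`, so its absolute integral over `(0, r)` does not depend
on `r`. What remains is an integrable Beta integrand in `r`. -/
lemma integrable_stieltjesKernel {ν : ℂ} (h1 : -1 < ν.re) (h2 : ν.re < 0) {ζ : ℂ}
    (hζ : ζ.im ≠ 0) : Integrable (stieltjesKernel ν ζ)
      ((volume.restrict (Ioc (0 : ℝ) 1)).prod (volume.restrict (Ioc (0 : ℝ) 1))) := by
  have hm := measurable_stieltjesKernel ν ζ
  have hζ' : 0 < |ζ.im| := abs_pos.mpr hζ
  have hinv : ∀ s : ℝ, ‖(ζ - (s : ℂ))⁻¹‖ ≤ |ζ.im|⁻¹ := fun s => by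
    rw [norm_inv]
    exact inv_anti₀ hζ' (abs_im_le_norm_sub_ofReal ζ s)
  have hA := fun r (hr : 0 < r) => integrableOn_cpow_mul_abs_cpow h1 h2 hr
  have hi : ∀ r : ℝ, 0 < r → IntegrableOn (fun s : ℝ => (s : ℂ) ^ ν
      * ((|s - r| : ℝ) : ℂ) ^ (-ν - 1) * (ζ - s)⁻¹ * ((r : ℂ) ^ ν * (1 - (r : ℂ)) ^ ν))
      (Ioc 0 r) := by
    intro r hr
    exact (Integrable.mul_bdd (c := |ζ.im|⁻¹) (hA r hr)
      (by fun_prop) (Eventually.of_forall hinv)).mul_const _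
  rw [integrable_prod_iff' hm.aestronglyMeasurable]
  constructor
  · filter_upwards [ae_restrict_mem measurableSet_Ioc] with r hr
    rw [stieltjesKernel_right, integrable_indicator_iff measurableSet_Iio, IntegrableOn,
      Measure.restrict_restrict measurableSet_Iio, inter_comm, Ioc_inter_Iio_of_le hr.2]
    exact (hi r hr.1).mono_set Ioo_subset_Ioc_self
  · have hb := (integrableOn_cpow_mul_one_sub_cpow h1).norm.const_mul
      ((∫ σ in Ioc (0 : ℝ) 1, ‖eulerWeight ν σ‖) * |ζ.im|⁻¹)
    refine hb.mono' hm.norm.stronglyMeasurable.integral_prod_left'.aestronglyMeasurable ?_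
    filter_upwards [ae_restrict_mem measurableSet_Ioc] with r hr
    rw [Real.norm_of_nonneg (integral_nonneg fun s => norm_nonneg _)]
    have e : (fun s => ‖stieltjesKernel ν ζ (s, r)‖) = (Iio r).indicator fun s =>
        ‖(s : ℂ) ^ ν * ((|s - r| : ℝ) : ℂ) ^ (-ν - 1) * (ζ - s)⁻¹
          * ((r : ℂ) ^ ν * (1 - (r : ℂ)) ^ ν)‖ := by
      ext s
      rw [congrFun (stieltjesKernel_right ν ζ r) s, norm_indicator_eq_indicator_norm]
    rw [e, setIntegral_indicator measurableSet_Iio, Ioc_inter_Iio_of_le hr.2,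
      ← integral_Ioc_eq_integral_Ioo]
    calc _ ≤ ∫ s in Ioc 0 r, ‖(s : ℂ) ^ ν * ((|s - r| : ℝ) : ℂ) ^ (-ν - 1)‖ * (|ζ.im|⁻¹
          * ‖(r : ℂ) ^ ν * (1 - (r : ℂ)) ^ ν‖) := by
          refine setIntegral_mono_on (hi r hr.1).norm ((hA r hr.1).norm.mul_const _)
            measurableSet_Ioc fun s _ => ?_
          rw [norm_mul _ ((r : ℂ) ^ ν * _), norm_mul _ (_ - _)⁻¹, mul_assoc]
          gcongr
          exact hinv s
      _ = _ := by
          have hr0 : (r : ℝ) ≠ 0 := hr.1.ne'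
          rw [integral_mul_const, integral_cpow_mul_abs_cpow ν hr.1 (fun _ z => ‖z‖)]
          simp only [norm_mul (r : ℂ)⁻¹, norm_inv, Complex.norm_real, Real.norm_of_nonneg hr.1.le]
          rw [integral_const_mul, smul_eq_mul, mul_inv_cancel_left₀ hr0]
          ring

/-- The Stieltjes transform of `legF ν` for degrees in the strip `-1 < Re ν < 0`. -/
lemma integral_legF_div_sub {ν : ℂ} (h1 : -1 < ν.re) (h2 : ν.re < 0) {ζ : ℂ} (hζ : ζ.im ≠ 0) :
    ∫ s in Ioc (0 : ℝ) 1, legF ν s / (ζ - s)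
      = ∫ r in Ioc (0 : ℝ) 1, (r : ℂ) ^ ν * (1 - (r : ℂ)) ^ ν
          * (ζ⁻¹ * (1 - r / ζ) ^ (-ν - 1)) := by
  have hζ0 : ζ ≠ 0 := by rintro rfl; simp at hζ
  have hB : betaLeg ν ≠ 0 := by
    intro h
    have := betaLeg_mul_sin h1 h2
    rw [h, zero_mul, eq_comm, neg_eq_zero] at this
    exact Real.pi_ne_zero (by exact_mod_cast this)
  refine mul_left_cancel₀ hB ?_
  have hswap := integral_integral_swap (f := fun s r => stieltjesKernel ν ζ (s, r))
    (μ := volume.restrict (Ioc (0 : ℝ) 1)) (ν := volume.restrict (Ioc (0 : ℝ) 1))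
    (integrable_stieltjesKernel h1 h2 hζ)
  rw [← integral_const_mul, ← integral_const_mul]
  calc _ = ∫ s in Ioc (0 : ℝ) 1, ∫ r in Ioc (0 : ℝ) 1, stieltjesKernel ν ζ (s, r) := by
        -- Schläfli's integral is available only for `s < 1`, so the endpoint is dropped.
        rw [integral_Ioc_eq_integral_Ioo, integral_Ioc_eq_integral_Ioo]
        refine setIntegral_congr_fun measurableSet_Ioo fun s hs => ?_
        have hset : Ioc (0 : ℝ) 1 ∩ Ioi s = Ioc s 1 := by
          ext r
          simp only [mem_inter_iff, mem_Ioc, mem_Ioi]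
          constructor
          · rintro ⟨⟨a, b⟩, c⟩; exact ⟨c, b⟩
          · rintro ⟨a, b⟩; exact ⟨⟨by linarith [hs.1], b⟩, a⟩
        rw [stieltjesKernel_left, setIntegral_indicator measurableSet_Ioi, hset,
          integral_const_mul, ← intervalIntegral.integral_of_le hs.2.le,
          integral_schlaefli_right h1 h2 hs.1 hs.2, legF]
        ring
    _ = _ := hswap
    _ = _ := by
        refine setIntegral_congr_fun measurableSet_Ioc fun r hr => ?_
        have hrc : (r : ℂ) ≠ 0 := by exact_mod_cast hr.1.ne'
        have hslit : 1 - (r : ℂ) / ζ ∈ Complex.slitPlane := by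
          right
          rw [Complex.sub_im, Complex.one_im, zero_sub, neg_ne_zero, Complex.div_im]
          simp [hζ, hr.1.ne', hζ0]
        have hpt : ∀ σ : ℝ, σ ∈ Ioc (0 : ℝ) 1 → (r : ℂ)⁻¹ * eulerWeight ν σ
            * (ζ - ((r * σ : ℝ) : ℂ))⁻¹
            = (r : ℂ)⁻¹ * ζ⁻¹ * (eulerWeight ν σ * (1 - r / ζ * σ)⁻¹) := by
          intro σ hσ
          have : (ζ - ((r * σ : ℝ) : ℂ)) = ζ * (1 - r / ζ * σ) := by
            push_cast
            field_simp
          rw [this, mul_inv]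
          ring
        rw [stieltjesKernel_right, setIntegral_indicator measurableSet_Iio,
          Ioc_inter_Iio_of_le hr.2, ← integral_Ioc_eq_integral_Ioo, integral_mul_const,
          integral_cpow_mul_abs_cpow ν hr.1 (fun s z => z * (ζ - s)⁻¹),
          setIntegral_congr_fun measurableSet_Ioc hpt, integral_const_mul,
          integral_eulerWeight_mul_inv h1 h2 hslit, Complex.real_smul]
        field_simp

/-! ### Boundary values on the cut -/

/-- The principal argument of `-w` is that of `w` plus `c * π`, the sign being fixed by the
half-plane of `w`. This is the source of the phase for `r > y`. -/
lemma neg_cpow_of_mul_im_neg {c : ℝ} (hc : c = 1 ∨ c = -1) {w : ℂ} (hw : c * w.im < 0) (α : ℂ) :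
    (-w) ^ α = Complex.exp (c * Real.pi * Complex.I * α) * w ^ α := by
  have hw0 : w ≠ 0 := by rintro rfl; simp at hw
  have harg : Complex.arg (-w) = Complex.arg w + c * Real.pi := by
    rcases hc with rfl | rfl
    · rw [Complex.arg_neg_eq_arg_add_pi_of_im_neg (by linarith), one_mul]
    · rw [Complex.arg_neg_eq_arg_sub_pi_of_im_pos (by linarith)]; ring
  have hlog : Complex.log (-w) = Complex.log w + c * Real.pi * Complex.I := by
    rw [Complex.log, Complex.log, norm_neg, harg]
    push_cast
    ring
  rw [Complex.cpow_def_of_ne_zero (neg_ne_zero.mpr hw0), Complex.cpow_def_of_ne_zero hw0, hlog,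
    ← Complex.exp_add]
  ring_nf

lemma inv_mul_div_cpow (ν : ℂ) {y t : ℝ} (hy : 0 < y) (ht : 0 ≤ t) :
    (y : ℂ)⁻¹ * ((t / y : ℝ) : ℂ) ^ (-ν - 1) = (y : ℂ) ^ ν * (t : ℂ) ^ (-ν - 1) := by
  have hyc : (y : ℂ) ≠ 0 := by exact_mod_cast hy.ne'
  have h1 : (t : ℂ) = ((y * (t / y) : ℝ) : ℂ) := by rw [mul_div_cancel₀ _ hy.ne']
  have e3 : (y : ℂ)⁻¹ = (y : ℂ) ^ ν * (y : ℂ) ^ (-ν - 1) := by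
    rw [← Complex.cpow_add _ _ hyc, show ν + (-ν - 1) = -1 by ring, Complex.cpow_neg_one]
  rw [h1, Complex.ofReal_mul, Complex.mul_cpow_ofReal_nonneg hy.le (by positivity), e3]
  ring

/-- On the vertical line through `y` both `‖ζ‖ ≥ y` and `‖ζ - r‖ ≥ |y - r|`, and the exponents `Re
ν` and `-Re ν - 1` are negative; the argument costs at most `exp (π |Im ν|)`. The bound dominates
the approach to the cut. -/
lemma norm_inv_mul_one_sub_div_cpow_le {ν : ℂ} (h1 : -1 < ν.re) (h2 : ν.re < 0) {y r : ℝ}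
    (hy : 0 < y) (hr : r ≠ y) {ζ : ℂ} (hζ : ζ.re = y) :
    ‖ζ⁻¹ * (1 - r / ζ) ^ (-ν - 1)‖
      ≤ y ^ ν.re * Real.exp (Real.pi * |ν.im|) * |y - r| ^ (-ν.re - 1) := by
  have hyZ : y ≤ ‖ζ‖ := hζ ▸ Complex.re_le_norm ζ
  have hrX : |y - r| ≤ ‖ζ - r‖ := by
    have := Complex.abs_re_le_norm (ζ - r)
    rwa [Complex.sub_re, hζ, Complex.ofReal_re] at this
  have hr0 : 0 < |y - r| := abs_pos.mpr (sub_ne_zero.mpr hr.symm)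
  have hZ : 0 < ‖ζ‖ := hy.trans_le hyZ
  have hX : 0 < ‖ζ - r‖ := hr0.trans_le hrX
  have hζ0 : ζ ≠ 0 := norm_pos_iff.mp hZ
  have e1 : 1 - (r : ℂ) / ζ = (ζ - r) / ζ := by field_simp
  have hexp : (Real.exp (Complex.arg ((ζ - r) / ζ) * (-ν - 1).im))⁻¹
      ≤ Real.exp (Real.pi * |ν.im|) := by
    rw [← Real.exp_neg]
    refine Real.exp_le_exp.mpr ((le_abs_self _).trans ?_)
    rw [abs_neg, abs_mul]
    have : |(-ν - 1).im| = |ν.im| := by simp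
    rw [this]
    gcongr
    exact Complex.abs_arg_le_pi _
  have e2 : ‖ζ‖⁻¹ * (‖ζ - r‖ / ‖ζ‖) ^ (-ν.re - 1) = ‖ζ‖ ^ ν.re * ‖ζ - r‖ ^ (-ν.re - 1) := by
    have : ‖ζ‖⁻¹ = ‖ζ‖ ^ ν.re * ‖ζ‖ ^ (-ν.re - 1) := by
      rw [← Real.rpow_add hZ, show ν.re + (-ν.re - 1) = -1 by ring, Real.rpow_neg_one]
    rw [Real.div_rpow hX.le hZ.le, this]
    have := (Real.rpow_pos_of_pos hZ (-ν.re - 1)).ne'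
    field_simp
  have h3 := Complex.norm_cpow_le ((ζ - r) / ζ) (-ν - 1)
  rw [norm_div, div_eq_mul_inv (_ ^ _)] at h3
  have hre : (-ν - 1).re = -ν.re - 1 := by simp
  rw [hre] at h3
  have hp1 := Real.rpow_le_rpow_of_nonpos hy hyZ h2.le
  have hp2 := Real.rpow_le_rpow_of_nonpos hr0 hrX (by linarith : -ν.re - 1 ≤ 0)
  rw [e1, norm_mul, norm_inv]
  calc _ ≤ ‖ζ‖⁻¹ * ((‖ζ - r‖ / ‖ζ‖) ^ (-ν.re - 1) * Real.exp (Real.pi * |ν.im|)) := by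
        gcongr
        exact h3.trans (by gcongr)
    _ = ‖ζ‖ ^ ν.re * ‖ζ - r‖ ^ (-ν.re - 1) * Real.exp (Real.pi * |ν.im|) := by
        rw [← mul_assoc, e2]
    _ ≤ y ^ ν.re * |y - r| ^ (-ν.re - 1) * Real.exp (Real.pi * |ν.im|) := by gcongr
    _ = _ := by ring

/-- The boundary values of the Stieltjes transform of `legF ν` on the cut. -/
lemma tendsto_integral_one_sub_div_cpow {ν : ℂ} (h1 : -1 < ν.re) (h2 : ν.re < 0) {y : ℝ}
    (hy0 : 0 < y) (hy1 : y < 1) {c : ℝ} (hc : c = 1 ∨ c = -1) :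
    Tendsto (fun ε : ℝ => ∫ r in Ioc (0 : ℝ) 1, (r : ℂ) ^ ν * (1 - (r : ℂ)) ^ ν
        * (((y : ℂ) + c * ε * Complex.I)⁻¹
          * (1 - r / ((y : ℂ) + c * ε * Complex.I)) ^ (-ν - 1))) (𝓝[>] 0)
      (𝓝 ((y : ℂ) ^ ν * betaLeg ν * (legP ν (1 - y)
        + Complex.exp (c * Real.pi * Complex.I * (-ν - 1)) * legP ν y))) := by
  let ζ : ℝ → ℂ := fun ε => (y : ℂ) + c * ε * Complex.I
  set e := Complex.exp (c * Real.pi * Complex.I * (-ν - 1)) with he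
  -- The pointwise limit of the integrand: `1 - r / ζ` tends to a positive number for `r < y`, and
  -- to the branch cut for `r > y`, where the phase `e` appears.
  let L : ℝ → ℂ := fun r => (y : ℂ) ^ ν * schlaefli ν y r * (if r ≤ y then 1 else e)
  have hyc : (y : ℂ) ≠ 0 := by exact_mod_cast hy0.ne'
  have hil := intervalIntegrable_schlaefli_left h1 h2 hy0 hy1
  have hir := intervalIntegrable_schlaefli_right h1 h2 hy0 hy1
  have hi : IntegrableOn (schlaefli ν y) (Ioc 0 1) :=
    (intervalIntegrable_iff_integrableOn_Ioc_of_le zero_le_one).mp (hil.trans hir)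
  have hil' := (intervalIntegrable_iff_integrableOn_Ioc_of_le hy0.le).mp hil
  have hir' := (intervalIntegrable_iff_integrableOn_Ioc_of_le hy1.le).mp hir
  have cl : EqOn L (fun r => (y : ℂ) ^ ν * schlaefli ν y r) (Ioc 0 y) := by
    intro r hr
    simp only [L, if_pos hr.2, mul_one]
  have cr : EqOn L (fun r => (y : ℂ) ^ ν * schlaefli ν y r * e) (Ioc y 1) := by
    intro r hr
    simp only [L, if_neg (not_le.mpr hr.1)]
  have hL : ∫ r in Ioc (0 : ℝ) 1, L r
      = (y : ℂ) ^ ν * betaLeg ν * (legP ν (1 - y) + e * legP ν y) := by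
    rw [← Ioc_union_Ioc_eq_Ioc hy0.le hy1.le, setIntegral_union
      (Ioc_disjoint_Ioc_of_le le_rfl) measurableSet_Ioc
      (IntegrableOn.congr_fun (hil'.const_mul _) cl.symm measurableSet_Ioc)
      (IntegrableOn.congr_fun ((hir'.const_mul _).mul_const _) cr.symm measurableSet_Ioc),
      setIntegral_congr_fun measurableSet_Ioc cl, setIntegral_congr_fun measurableSet_Ioc cr,
      integral_mul_const, integral_const_mul, integral_const_mul,
      ← intervalIntegral.integral_of_le hy0.le, ← intervalIntegral.integral_of_le hy1.le,
      integral_schlaefli_left h1 h2 hy0 hy1, integral_schlaefli_right h1 h2 hy0 hy1]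
    ring
  have hne : ∀ᵐ r ∂(volume.restrict (Ioc (0 : ℝ) 1)), r ≠ y :=
    ae_restrict_of_ae (by simp [ae_iff, measure_singleton])
  have hζre : ∀ ε, (ζ ε).re = y := fun ε => by simp [ζ]
  have hζim : ∀ ε, (ζ ε).im = c * ε := fun ε => by simp [ζ]
  have hζlim : Tendsto ζ (𝓝[>] 0) (𝓝 y) := by
    have : Continuous ζ := by fun_prop
    have h := this.tendsto 0
    simp only [ζ, Complex.ofReal_zero, mul_zero, zero_mul, add_zero] at h
    exact h.mono_left nhdsWithin_le_nhds
  rw [← hL]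
  refine tendsto_integral_filter_of_dominated_convergence
    (fun r => ‖schlaefli ν y r‖ * (y ^ ν.re * Real.exp (Real.pi * |ν.im|))) ?_ ?_
    (hi.norm.mul_const _) ?_
  · exact Eventually.of_forall fun ε => Measurable.aestronglyMeasurable (by fun_prop)
  · refine Eventually.of_forall fun ε => ?_
    filter_upwards [hne] with r hr
    have hb := norm_inv_mul_one_sub_div_cpow_le h1 h2 hy0 hr (hζre ε)
    have hr0 : 0 < |y - r| := abs_pos.mpr (sub_ne_zero.mpr hr.symm)
    have hre : (-ν - 1).re = -ν.re - 1 := by simp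
    rw [schlaefli, norm_mul, norm_mul (_ * _), Complex.norm_cpow_eq_rpow_re_of_pos hr0, hre]
    exact (mul_le_mul_of_nonneg_left hb (norm_nonneg _)).trans_eq (by ring)
  · filter_upwards [hne, ae_restrict_mem measurableSet_Ioc] with r hr hr1
    have hdiv : Tendsto (fun ε => (r : ℂ) / ζ ε) (𝓝[>] 0) (𝓝 (r / y)) :=
      tendsto_const_nhds.div hζlim hyc
    rcases lt_or_gt_of_ne hr with hlt | hgt
    · have hval : L r = (r : ℂ) ^ ν * (1 - (r : ℂ)) ^ ν * ((y : ℂ)⁻¹ * (1 - r / y) ^ (-ν - 1)) := by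
        have h := inv_mul_div_cpow ν hy0 (sub_nonneg.mpr hlt.le)
        rw [show (((y - r) / y : ℝ) : ℂ) = 1 - r / y by push_cast; field_simp] at h
        have h3 := cl ⟨hr1.1, hlt.le⟩
        simp only [schlaefli, abs_of_pos (sub_pos.mpr hlt)] at h3
        rw [h3, h]
        ring
      rw [hval]
      refine Tendsto.const_mul _ ((hζlim.inv₀ hyc).mul ?_)
      have hs : (1 : ℂ) - r / y ∈ Complex.slitPlane := by
        left
        rw [← Complex.ofReal_div, Complex.sub_re, Complex.one_re, Complex.ofReal_re, sub_pos,
          div_lt_one hy0]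
        exact hlt
      exact (continuousAt_cpow_const hs).tendsto.comp (hdiv.const_sub 1)
    · have hval : L r = (r : ℂ) ^ ν * (1 - (r : ℂ)) ^ ν
          * ((y : ℂ)⁻¹ * (e * (r / y - 1) ^ (-ν - 1))) := by
        have h := inv_mul_div_cpow ν hy0 (sub_nonneg.mpr hgt.le)
        rw [show (((r - y) / y : ℝ) : ℂ) = r / y - 1 by push_cast; field_simp] at h
        have h3 := cr ⟨hgt, hr1.2⟩
        simp only [schlaefli, abs_of_neg (sub_neg.mpr hgt), neg_sub] at h3
        rw [h3]
        linear_combination (-(r : ℂ) ^ ν * (1 - (r : ℂ)) ^ ν * e) * h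
      rw [hval]
      refine Tendsto.const_mul _ ((hζlim.inv₀ hyc).mul ?_)
      have hs : (r : ℂ) / y - 1 ∈ Complex.slitPlane := by
        left
        rw [← Complex.ofReal_div, Complex.sub_re, Complex.one_re, Complex.ofReal_re, sub_pos,
          one_lt_div hy0]
        exact hgt
      refine (((continuousAt_cpow_const hs).tendsto.comp (hdiv.sub_const 1)).const_mul e).congr' ?_
      filter_upwards [self_mem_nhdsWithin] with ε (hε : 0 < ε)
      have him : c * ((r : ℂ) / ζ ε - 1).im < 0 := by
        have hn : 0 < Complex.normSq (ζ ε) := by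
          rw [Complex.normSq_pos]
          intro h0
          have := hζre ε
          rw [h0, Complex.zero_re] at this
          linarith
        rw [Complex.sub_im, Complex.one_im, sub_zero, Complex.div_im, hζim, Complex.ofReal_im,
          Complex.ofReal_re, zero_mul, zero_div, zero_sub, mul_neg, neg_lt_zero, ← mul_div_assoc]
        refine div_pos ?_ hn
        have : c * (r * (c * ε)) = r * ε * (c * c) := by ring
        rw [this]
        have hc2 : c * c = 1 := by rcases hc with rfl | rfl <;> norm_num
        rw [hc2, mul_one]
        exact mul_pos hr1.1 hε
      have := neg_cpow_of_mul_im_neg hc him (-ν - 1)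
      rw [neg_sub] at this
      simp only [Function.comp_apply]
      exact this.symm

/-! ### Identification with `Q_ν` and continuation in the degree -/

/-- The principal value in the strip `-1 < Re ν < 0`. -/
lemma sin_mul_pvLegF_of_strip {ν : ℂ} (h1 : -1 < ν.re) (h2 : ν.re < 0) {y : ℝ}
    (hy0 : 0 < y) (hy1 : y < 1) :
    Complex.sin (ν * Real.pi) * pvLegF y ν = Real.pi * (y : ℂ) ^ ν
      * (Complex.cos (ν * Real.pi) * legP ν y - legP ν (1 - y)) := by
  have hS := tendsto_stieltjes_add_stieltjes hy0 hy1 (f := legF ν)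
    (integrableOn_cpow_mul_legP ν h1) (integrableOn_legF_slope h1 hy0 hy1.le)
  have hT := (tendsto_integral_one_sub_div_cpow h1 h2 hy0 hy1 (Or.inl rfl)).add
    (tendsto_integral_one_sub_div_cpow h1 h2 hy0 hy1 (Or.inr rfl))
  have huniq := tendsto_nhds_unique (hT.congr' ?_) hS
  -- The phases from the two sides of the cut add up to `2 cos(π (ν + 1))`.
  · have hcos : Complex.exp ((1 : ℝ) * Real.pi * Complex.I * (-ν - 1))
        + Complex.exp ((-1 : ℝ) * Real.pi * Complex.I * (-ν - 1))
        = -(2 * Complex.cos (ν * Real.pi)) := by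
      rw [← mul_neg, ← Complex.cos_add_pi, Complex.two_cos, add_comm]
      push_cast
      ring_nf
    rw [pvLegF]
    have hB := betaLeg_mul_sin h1 h2
    linear_combination (-(Complex.sin (ν * Real.pi)) / 2) * huniq
      + (Complex.sin (ν * Real.pi) / 2 * (y : ℂ) ^ ν * betaLeg ν * legP ν y) * hcos
      + (y : ℂ) ^ ν * (legP ν (1 - y) - Complex.cos (ν * Real.pi) * legP ν y) * hB
  · filter_upwards [self_mem_nhdsWithin] with ε (hε : 0 < ε)
    rw [← integral_legF_div_sub h1 h2 (by simp [hε.ne']),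
      ← integral_legF_div_sub h1 h2 (by simp [hε.ne'])]
    push_cast
    simp only [one_mul, neg_mul, ← sub_eq_add_neg]

/-- Both sides are holomorphic on the half-plane `Re ν > -1`, which is convex, and agree near `-1 /
2`. -/
lemma sin_mul_pvLegF {ν : ℂ} (h1 : -1 < ν.re) {y : ℝ} (hy0 : 0 < y) (hy1 : y < 1) :
    Complex.sin (ν * Real.pi) * pvLegF y ν = Real.pi * (y : ℂ) ^ ν
      * (Complex.cos (ν * Real.pi) * legP ν y - legP ν (1 - y)) := by
  have hU := isOpen_re_gt_neg_one
  have hyc : (y : ℂ) ≠ 0 := by exact_mod_cast hy0.ne'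
  have hL : DifferentiableOn ℂ (fun ν => Complex.sin (ν * Real.pi) * pvLegF y ν)
      {ν | -1 < ν.re} :=
    DifferentiableOn.mul (by fun_prop) (differentiableOn_pvLegF hy0 hy1.le)
  have hP1 := differentiable_legP hy0 hy1.le
  have hP2 := differentiable_legP (s := 1 - y) (by linarith) (by linarith)
  have hpow : Differentiable ℂ fun ν : ℂ => (y : ℂ) ^ ν :=
    differentiable_id.const_cpow (Or.inl hyc)
  have hR : DifferentiableOn ℂ (fun ν => Real.pi * (y : ℂ) ^ ν
      * (Complex.cos (ν * Real.pi) * legP ν y - legP ν (1 - y))) {ν | -1 < ν.re} := by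
    fun_prop
  refine (hL.analyticOnNhd hU).eqOn_of_preconnected_of_eventuallyEq (hR.analyticOnNhd hU)
    (convex_halfSpace_re_gt (-1)).isPreconnected (z₀ := -1 / 2) (by simp; norm_num) ?_ h1
  have hV : IsOpen {ν : ℂ | -1 < ν.re ∧ ν.re < 0} :=
    hU.inter (isOpen_lt Complex.continuous_re continuous_const)
  filter_upwards [hV.mem_nhds (by simp; norm_num : (-1 / 2 : ℂ) ∈ _)] with ν hν
  exact sin_mul_pvLegF_of_strip hν.1 hν.2 hy0 hy1

lemma legendreQFormula_eq_pvLegF {ν : ℂ} (h1 : -1 < ν.re) (hsin : Complex.sin (ν * Real.pi) ≠ 0)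
    {x : ℝ} (hx1 : -1 < x) (hx2 : x < 1) :
    legendreQFormula ν x = pvLegF ((1 + x) / 2) ν / (2 * (((1 + x) / 2 : ℝ) : ℂ) ^ ν) := by
  have hy0 : 0 < (1 + x) / 2 := by linarith
  have h := sin_mul_pvLegF h1 hy0 (by linarith : (1 + x) / 2 < 1)
  have hpow : (((1 + x) / 2 : ℝ) : ℂ) ^ ν ≠ 0 := by
    rw [Complex.cpow_ne_zero_iff]
    exact Or.inl (by exact_mod_cast hy0.ne')
  have e : 1 - (1 + x) / 2 = (1 + -x) / 2 := by ring
  rw [e] at h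
  rw [legendreQFormula, legendreP_eq_legP, legendreP_eq_legP, eq_div_iff (by simpa using hpow),
    div_mul_eq_mul_div, div_mul_eq_mul_div, div_eq_iff (mul_ne_zero two_ne_zero hsin)]
  linear_combination -2 * h

lemma sin_mul_pi_ne_zero_of_forall_ne {ν : ℂ} (h : ∀ m : ℤ, ν ≠ m) :
    Complex.sin (ν * Real.pi) ≠ 0 := by
  rw [Complex.sin_ne_zero_iff]
  intro k hk
  exact h k (mul_right_cancel₀ (by exact_mod_cast Real.pi_ne_zero) hk)

/-- At integers the right side is continuous in the degree and agrees with the explicit formula at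
nearby noninteger degrees, so it is the limit defining `Q_m`. -/
lemma legendreQ_eq_pvLegF {ν : ℂ} (h1 : -1 < ν.re) {x : ℝ} (hx1 : -1 < x) (hx2 : x < 1) :
    legendreQ ν x = pvLegF ((1 + x) / 2) ν / (2 * (((1 + x) / 2 : ℝ) : ℂ) ^ ν) := by
  have hy0 : 0 < (1 + x) / 2 := by linarith
  have hyc : (((1 + x) / 2 : ℝ) : ℂ) ≠ 0 := by exact_mod_cast hy0.ne'
  rw [legendreQ]
  split_ifs with hν
  · obtain ⟨m, rfl⟩ := hν
    refine Tendsto.limUnder_eq ?_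
    have hnhds := isOpen_re_gt_neg_one.mem_nhds h1
    have hcont : ContinuousAt (fun μ : ℂ => pvLegF ((1 + x) / 2) μ
        / (2 * (((1 + x) / 2 : ℝ) : ℂ) ^ μ)) m := by
      refine ContinuousAt.div ((differentiableOn_pvLegF hy0
        (by linarith)).differentiableAt hnhds).continuousAt
        (continuousAt_const.mul (continuousAt_const_cpow hyc)) ?_
      exact mul_ne_zero two_ne_zero (by rw [Complex.cpow_ne_zero_iff]; exact Or.inl hyc)
    refine (hcont.tendsto.mono_left nhdsWithin_le_nhds).congr' ?_
    -- The punctured unit ball about an integer contains no integer, so the sine is nonzero there.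
    filter_upwards [nhdsWithin_le_nhds hnhds,
      nhdsWithin_le_nhds (Metric.ball_mem_nhds (m : ℂ) one_pos), self_mem_nhdsWithin]
      with μ hμ1 hμ2 hμ3
    refine (legendreQFormula_eq_pvLegF hμ1 (sin_mul_pi_ne_zero_of_forall_ne fun k hk => hμ3 ?_)
      hx1 hx2).symm
    rw [hk, Metric.mem_ball, Complex.dist_eq, ← Int.cast_sub, Complex.norm_intCast] at hμ2
    have : |k - m| < 1 := by exact_mod_cast hμ2
    rw [Int.abs_lt_one_iff, sub_eq_zero] at this
    rw [hk, this]
    rfl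
  · push Not at hν
    exact legendreQFormula_eq_pvLegF h1 (sin_mul_pi_ne_zero_of_forall_ne hν) hx1 hx2

/-! ### Lowering the power and return to the original variable -/

lemma _root_.HasCauchyPV.congr {f g : ℝ → ℂ} {a b c : ℝ} {I : ℂ} (hac : a < c) (hcb : c < b)
    (h : HasCauchyPV f a b c I) (hfg : EqOn f g (Ioc a b)) : HasCauchyPV g a b c I := by
  have hl : ∀ ε, 0 < ε → a < c - ε → EqOn f g (uIoc a (c - ε)) := by
    intro ε h1 h2 s hs
    rw [uIoc_of_le h2.le] at hs
    exact hfg ⟨hs.1, by linarith [hs.2]⟩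
  have hr : ∀ ε, 0 < ε → c + ε < b → EqOn f g (uIoc (c + ε) b) := by
    intro ε h1 h2 s hs
    rw [uIoc_of_le h2.le] at hs
    exact hfg ⟨by linarith [hs.1], hs.2⟩
  refine ⟨fun ε h1 h2 h3 => ⟨(h.1 ε h1 h2 h3).1.congr (hl ε h1 h2),
    (h.1 ε h1 h2 h3).2.congr (hr ε h1 h3)⟩, h.2.congr' ?_⟩
  filter_upwards [Ioo_mem_nhdsGT (lt_min (sub_pos.mpr hac) (sub_pos.mpr hcb))] with ε hε
  have h1 := hε.2.trans_le (min_le_left _ _)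
  have h2 := hε.2.trans_le (min_le_right _ _)
  rw [intervalIntegral.integral_congr_ae (Eventually.of_forall fun s => @hl ε hε.1 (by linarith) s),
    intervalIntegral.integral_congr_ae (Eventually.of_forall fun s => @hr ε hε.1 (by linarith) s)]

lemma _root_.HasCauchyPV.const_mul {f : ℝ → ℂ} {a b c : ℝ} {I : ℂ} (k : ℂ) (h : HasCauchyPV f a b c I) :
    HasCauchyPV (fun s => k * f s) a b c (k * I) := by
  refine ⟨fun ε h1 h2 h3 => ⟨(h.1 ε h1 h2 h3).1.const_mul k, (h.1 ε h1 h2 h3).2.const_mul k⟩, ?_⟩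
  refine (h.2.const_mul k).congr fun ε => ?_
  rw [intervalIntegral.integral_const_mul, intervalIntegral.integral_const_mul, mul_add]

lemma hasCauchyPV_cpow_mul_legP (n : ℕ) {ν : ℂ} (hν : -1 < (ν - (n : ℂ)).re) {y : ℝ}
    (hy0 : 0 < y) (hy1 : y < 1) :
    HasCauchyPV (fun s : ℝ => (s : ℂ) ^ (ν - (n : ℂ)) * legP ν s / (y - s)) 0 1 y
      (pvLegF y ν / (y : ℂ) ^ n) := by
  induction n with
  | zero =>
    have h1 : -1 < ν.re := by simpa using hν
    simpa [legF, pvLegF] using hasCauchyPV_of_integrableOn_slope hy0 hy1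
      (integrableOn_legF_slope h1 hy0 hy1.le)
  | succ n ih =>
    have h0 : -1 < (ν - (n : ℂ)).re := by
      simp at hν ⊢
      linarith
    have hint := integrableOn_cpow_mul_legP ν hν
    have h := HasCauchyPV.of_mul (I := pvLegF y ν / (y : ℂ) ^ n) hy0 hy1 hint
      ((ih h0).congr hy0 hy1 fun s hs => ?_)
    · rw [integral_cpow_mul_legP_eq_zero ν n hν, add_zero, div_div, ← pow_succ] at h
      exact h
    · have hs0 : (s : ℂ) ≠ 0 := by exact_mod_cast hs.1.ne'
      have : (s : ℂ) ^ (ν - (n : ℂ)) = s * (s : ℂ) ^ (ν - ((n + 1 : ℕ) : ℂ)) := by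
        rw [show ν - (n : ℂ) = 1 + (ν - ((n + 1 : ℕ) : ℂ)) by push_cast; ring,
          Complex.cpow_add _ _ hs0, Complex.cpow_one]
      rw [this, mul_assoc]

end

end LegendreNeumann

open LegendreNeumann in
theorem mainTheorem7 (n : ℕ) (ν : ℂ) (hν : -1 < (ν - (n : ℂ)).re)
    (x : ℝ) (hx₁ : -1 < x) (hx₂ : x < 1) :
    HasCauchyPV
      (fun ξ : ℝ => (1 + (ξ : ℂ)) ^ (ν - (n : ℂ)) * legendreP ν ξ / (2 * ((x : ℂ) - (ξ : ℂ))))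
      (-1) 1 x
      ((1 + (x : ℂ)) ^ (ν - (n : ℂ)) * legendreQ ν x) := by
  have hy0 : 0 < (1 + x) / 2 := by linarith
  have hre : -1 < ν.re := by
    simp at hν
    linarith [n.cast_nonneg (α := ℝ)]
  have hyc : (((1 + x) / 2 : ℝ) : ℂ) ≠ 0 := by exact_mod_cast hy0.ne'
  have hpow : (((1 + x) / 2 : ℝ) : ℂ) ^ ν ≠ 0 := by
    rw [Complex.cpow_ne_zero_iff]
    exact Or.inl hyc
  have htwo : ∀ ξ : ℝ, -1 ≤ ξ → (1 + (ξ : ℂ)) ^ (ν - (n : ℂ))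
      = 2 ^ (ν - (n : ℂ)) * (((1 + ξ) / 2 : ℝ) : ℂ) ^ (ν - (n : ℂ)) := by
    intro ξ hξ
    have := Complex.mul_cpow_ofReal_nonneg zero_le_two (by linarith : 0 ≤ (1 + ξ) / 2)
      (ν - (n : ℂ))
    rw [← Complex.ofReal_mul, mul_div_cancel₀ _ two_ne_zero, Complex.ofReal_ofNat] at this
    rw [← this]
    push_cast
    rfl
  -- The constant comes from `1 + ξ = 2 s` and `2 (x - ξ) = 4 (y - s)`; `HasCauchyPV.comp_affine`
  -- supplies the factor `2` of `dξ = 2 ds`.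
  have h := ((hasCauchyPV_cpow_mul_legP n hν hy0 (by linarith)).comp_affine).const_mul
    (2 ^ (ν - (n : ℂ)) / 4)
  have hval : 2 ^ (ν - (n : ℂ)) / 4 * (2 * (pvLegF ((1 + x) / 2) ν
      / (((1 + x) / 2 : ℝ) : ℂ) ^ n)) = (1 + (x : ℂ)) ^ (ν - (n : ℂ)) * legendreQ ν x := by
    rw [legendreQ_eq_pvLegF hre hx₁ hx₂, htwo x hx₁.le,
      Complex.cpow_sub _ _ hyc, Complex.cpow_natCast]
    field_simp
    ring
  rw [hval] at h
  refine h.congr hx₁ hx₂ fun ξ hξ => ?_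
  rw [htwo ξ hξ.1.le, legendreP_eq_legP,
    show 2 * ((x : ℂ) - ξ) = 4 * ((((1 + x) / 2 : ℝ) : ℂ) - (((1 + ξ) / 2 : ℝ) : ℂ)) by
      push_cast; ring, div_mul_div_comm, mul_assoc]
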